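/- Let $\Omega$ be either a bounded open interval $(a,b)$, $a<b$, or $\mathbb R$; test functions $\varphi\in C_0^\infty(\Omega)$ are extended by zero to $\mathbb R$. For $n-1<\alpha<n$ ($n\in\mathbb N$) let $${}^{-}D^{\alpha}\varphi(x)=\frac{1}{\Gamma(n-\alpha)}\frac{d^n}{dx^n}\int_{-\infty}^x\frac{\varphi(y)}{(x-y)^{1+\alpha-n}}\,dy,\qquad {}^{+}D^{\alpha}\varphi(x)=\frac{(-1)^n}{\Gamma(n-\alpha)}\frac{d^n}{dx^n}\int_x^{\infty}\frac{\varphi(y)}{(y-x)^{1+\alpha-n}}\,dy ,$$ and let ${}^{\pm}D^{\alpha}\varphi=\varphi^{(\alpha)}$ if $\alpha\ge 0$ is an integer. Let $[\alpha]$ be the integer part of $\alpha$. For $u\in L^1(\Omega)$ and $\alpha\ge0$, a function $v\in L^1_{loc}(\Omega)$ is the weak fractional derivative ${}^{\pm}\mathcal D^\alpha u$ (left for $-$, right for $+$) if $$\int_\Omega v\,\varphi\,dx=(-1)^{[\alpha]}\int_\Omega u\;{}^{\mp}D^\alpha\varphi\,dx\qquad\forall\varphi\in C_0^\infty(\Omega);$$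 thus ${}^{\pm}\mathcal D^0u=u$. $\mathcal D^m$ denotes the usual weak derivative of integer order $m$ of functions in $L^1_{loc}(\Omega)$, with values in $L^1_{loc}(\Omega)$, and $\mathcal D=\mathcal D^1$. All identities between functions hold almost everywhere in $\Omega$. Then, for each of the two signs: (i) (Linearity) Let $\alpha>0$ and $\lambda,\mu\in\mathbb R$. If ${}^{\pm}\mathcal D^\alpha u$ and ${}^{\pm}\mathcal D^\alpha v$ exist, then ${}^{\pm}\mathcal D^\alpha(\lambda u+\mu v)$ exists and equals $\lambda\,{}^{\pm}\mathcal D^\alpha u+\mu\,{}^{\pm}\mathcal D^\alpha v$. (ii) (Inclusivity) Let $0<\alpha<\beta<1$. If ${}^{\pm}\mathcal D^\beta u$ exists, then ${}^{\pm}\mathcal D^\alpha u$ exists. (iii) (Semigroup) Let $\alpha,\beta>0$ and $\alpha+\beta<1$. If ${}^{\pm}\mathcal D^\alpha u$, ${}^{\pm}\mathcal D^\beta u$, ${}^{\pm}\mathcal D^{\alpha+\beta}u$ exist and belong to $L^1(\Omega)$, then ${}^{\pm}\mathcal D^\alpha\,{}^{\pm}\mathcal D^\beta u$ exists and equals ${}^{\pm}\mathcal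 D^{\alpha+\beta}u$. Moreover, let $\alpha>1$, $\sigma=\alpha-[\alpha]$ and $u\in L^1(\Omega)$. Then ${}^{\pm}\mathcal D^\alpha u$ exists if and only if ${}^{\pm}\mathcal D^\sigma u$ and $\mathcal D^{[\alpha]}({}^{\pm}\mathcal D^\sigma u)$ exist, and in this case $${}^{+}\mathcal D^\alpha u=\mathcal D^{[\alpha]}({}^{+}\mathcal D^\sigma u),\qquad {}^{-}\mathcal D^\alpha u=\varepsilon_\alpha\,\mathcal D^{[\alpha]}({}^{-}\mathcal D^\sigma u),$$ where $\varepsilon_\alpha=(-1)^{[\alpha]}$ if $\alpha$ is not an integer and $\varepsilon_\alpha=1$ if it is. (iv) (Consistency) Let $u\in L^1(\Omega)$ have a first-order weak derivative $\mathcal Du\in L^1_{loc}(\Omega)$. Then ${}^{\pm}\mathcal D^\alpha u$ exists for all $0<\alpha<1$, and as $\alpha\to1^-$ the left derivatives ${}^{-}\mathcal D^\alpha u$ converge to $\mathcal Du$ and the right derivatives ${}^{+}\mathcal D^\alpha u$ converge to $-\mathcal Du$, in the following two senses: $\int_\Omega{}^{\mp}\mathcal D^\alpha u\,\varphi\,dx\to\pm\int_\Omega\mathcal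 Du\,\varphi\,dx$ for all $\varphi\in C_0^\infty(\Omega)$; and, for every sequence $\alpha_k\in(0,1)$ with $\alpha_k\to1$, ${}^{\mp}\mathcal D^{\alpha_k}u\to\pm\mathcal Du$ almost everywhere in $\Omega$ (upper signs: left derivatives; lower signs: right derivatives). -/

import Mathlib

open MeasureTheory Filter Topology Set
open scoped ContDiff

namespace WeakFrac

/-- The two directions of fractional calculus: `left` (operators carrying the index `-`)
and `right` (operators carrying the index `+`). -/
inductive Side where
  | left : Side
  | right : Side

/-- The opposite direction. -/
def Side.opp : Side → Side
  | .left => .right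
  | .right => .left

/-- The sign `1` for the left and `-1` for the right direction. -/
def Side.sign : Side → ℝ
  | .left => 1
  | .right => -1

/-- The domains considered: the whole line or a bounded nonempty open interval. -/
def IsDomain (Ω : Set ℝ) : Prop :=
  Ω = Set.univ ∨ ∃ a b : ℝ, a < b ∧ Ω = Set.Ioo a b

/-- `C_0^∞(Ω)`; its elements are regarded as functions on the line, i.e. extended by zero. -/
def IsTestFunction (Ω : Set ℝ) (φ : ℝ → ℝ) : Prop :=
  ContDiff ℝ ∞ φ ∧ HasCompactSupport φ ∧ tsupport φ ⊆ Ω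

/-- The left and right (Riemann–)Liouville fractional integrals of order `σ > 0` on the line. -/
noncomputable def fracIntegral : Side → ℝ → (ℝ → ℝ) → ℝ → ℝ
  | .left, σ, f, x => (Real.Gamma σ)⁻¹ * ∫ y in Set.Iio x, f y / (x - y) ^ (1 - σ)
  | .right, σ, f, x => (Real.Gamma σ)⁻¹ * ∫ y in Set.Ioi x, f y / (y - x) ^ (1 - σ)

/-- The classical left and right (Riemann–)Liouville derivatives of order `α ≥ 0` on the line:
for `n - 1 < α < n` the left one is `dⁿ/dxⁿ I^{n-α} f` and the right one is
`(-1)ⁿ dⁿ/dxⁿ I^{n-α} f`; for integer `α` both are the ordinary derivative of order `α`. -/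
noncomputable def classicalDeriv (s : Side) (α : ℝ) (f : ℝ → ℝ) (x : ℝ) : ℝ :=
  if (⌊α⌋₊ : ℝ) = α then iteratedDeriv ⌊α⌋₊ f x
  else s.sign ^ (⌊α⌋₊ + 1) *
    iteratedDeriv (⌊α⌋₊ + 1) (fracIntegral s ((⌊α⌋₊ : ℝ) + 1 - α) f) x

/-- `v` is the left / right weak fractional derivative of order `α` of `u` on `Ω`. The test
function is differentiated in the opposite direction. For `α = 0` this says `v = u` a.e. on `Ω`. -/
def IsWeakFracDeriv (s : Side) (Ω : Set ℝ) (α : ℝ) (u v : ℝ → ℝ) : Prop :=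
  IntegrableOn u Ω volume ∧ LocallyIntegrableOn v Ω volume ∧
    ∀ φ : ℝ → ℝ, IsTestFunction Ω φ →
      ∫ x in Ω, v x * φ x = (-1) ^ ⌊α⌋₊ * ∫ x in Ω, u x * classicalDeriv s.opp α φ x

/-- `v` is the ordinary weak derivative of integer order `m` of the locally integrable `w`. -/
def IsWeakDeriv (Ω : Set ℝ) (m : ℕ) (w v : ℝ → ℝ) : Prop :=
  LocallyIntegrableOn w Ω volume ∧ LocallyIntegrableOn v Ω volume ∧
    ∀ φ : ℝ → ℝ, IsTestFunction Ω φ →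
      ∫ x in Ω, v x * φ x = (-1) ^ m * ∫ x in Ω, w x * iteratedDeriv m φ x

end WeakFrac

namespace WeakFrac

/-! ### The Riemann–Liouville kernel -/

/-! Extend `u` by zero outside `Ω` and write `I^γ` for fractional integration. Non-integer right
derivatives reduce to left ones by the reflection `x ↦ -x`. For `0 < α < 1` the classical right
derivative of a test function `φ` is minus the right integral of order `1 - α` of `φ'`, and left and
right integration are adjoint (`integral_mul_rightInt`). Hence the left weak derivative of order `α`
is the ordinary weak derivative of `I^{1-α} u` (`isWeakFracDeriv_left_iff_isWeakDeriv`).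

Orders above one: if `σ` is the fractional part, the weak derivative is, up to sign, the
distributional derivative of order `[α] + 1` of `J = I^{1-σ} u`. On an interval a distribution with
locally integrable derivative is itself locally integrable (`exists_lower_deriv`), so all lower
derivatives of `J` exist, in particular `J'`, which is the derivative of order `σ`.

Inclusivity and consistency both need that `I^γ f` is weakly differentiable when `f` is. Its
derivative is the Marchaud integral of `(f x - f (x - t)) t^(γ - 2)`, which converges locally in
`L¹` because the increments of `f` are `O(t)` in mean (`marchaud_of_isWeakDeriv`). Inclusivity takes
`f = I^{1-β} u`, `γ = β - α`; consistency takes `f = u`, `γ = 1 - α`. As `γ → 0` the normalised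
weight concentrates at `t = 0` and picks out the derivative wherever the primitive representing `u`
is differentiable, thus almost everywhere (`tendsto_marchaud`).

Semigroup: if `q` is the derivative of order `β`, then `I^{1-β} u = C + I^1 q` on `Ω`. On the line
`C` is harmless, since it is paired with a function of integral zero. On `(a, b)` it vanishes:
`I^{1-α-β} u` is bounded because its derivative is integrable, so `I^{1-β} u`, its integral of order
`α`, is `O((x - a)^α)` (`ae_eq_leftInt_one_of_Ioo`). Two integrations by parts then finish. -/

/-- The kernel `t ^ (γ - 1) / Γ(γ)` of fractional integration, supported on `(0, ∞)`. -/
noncomputable def rlKernel (γ t : ℝ) : ℝ := if 0 < t then t ^ (γ - 1) / Real.Gamma γ else 0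

/-- The right fractional integral, as an integral against the kernel. -/
noncomputable def rightInt (γ : ℝ) (f : ℝ → ℝ) (x : ℝ) : ℝ := ∫ t, rlKernel γ t * f (x + t)

/-- The left fractional integral, as an integral against the kernel. -/
noncomputable def leftInt (γ : ℝ) (f : ℝ → ℝ) (x : ℝ) : ℝ := ∫ t, rlKernel γ t * f (x - t)

lemma rlKernel_of_pos {γ t : ℝ} (ht : 0 < t) :
    rlKernel γ t = t ^ (γ - 1) / Real.Gamma γ := if_pos ht

lemma rlKernel_of_nonpos {γ t : ℝ} (ht : t ≤ 0) : rlKernel γ t = 0 := if_neg ht.not_gt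

lemma rlKernel_nonneg {γ : ℝ} (hγ : 0 < γ) (t : ℝ) : 0 ≤ rlKernel γ t := by
  unfold rlKernel
  split_ifs with h
  · exact div_nonneg (Real.rpow_nonneg h.le _) (Real.Gamma_pos_of_pos hγ).le
  · exact le_rfl

lemma measurable_rlKernel (γ : ℝ) : Measurable (rlKernel γ) := by
  unfold rlKernel
  exact Measurable.ite measurableSet_Ioi (by fun_prop) (by fun_prop)

lemma rlKernel_one (t : ℝ) : rlKernel 1 t = (Ioi (0 : ℝ)).indicator 1 t := by
  by_cases h : 0 < t <;> simp [rlKernel, h]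

lemma leftInt_eq_rightInt (γ : ℝ) (f : ℝ → ℝ) (x : ℝ) :
    leftInt γ f x = rightInt γ (fun y => f (-y)) (-x) := by
  unfold leftInt rightInt
  congr 1; ext t; congr 2; ring

lemma integrableOn_rlKernel_Ioc {γ : ℝ} (hγ : 0 < γ) (R : ℝ) :
    IntegrableOn (rlKernel γ) (Ioc 0 R) := by
  rcases le_total R 0 with hR | hR
  · simp [Ioc_eq_empty_of_le hR]
  have h : IntegrableOn (fun t : ℝ => t ^ (γ - 1) / Real.Gamma γ) (Ioc 0 R) :=
    ((intervalIntegrable_iff_integrableOn_Ioc_of_le hR).1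
      (intervalIntegral.intervalIntegrable_rpow' (by linarith))).div_const _
  exact h.congr_fun (fun t ht => (rlKernel_of_pos ht.1).symm) measurableSet_Ioc

lemma integral_rlKernel_Ioc {γ : ℝ} (hγ : 0 < γ) {R : ℝ} (hR : 0 ≤ R) :
    ∫ t in Ioc 0 R, rlKernel γ t = R ^ γ / Real.Gamma (γ + 1) := by
  rw [setIntegral_congr_fun measurableSet_Ioc
    (fun t ht => rlKernel_of_pos (γ := γ) ht.1), integral_div,
    ← intervalIntegral.integral_of_le hR, integral_rpow (Or.inl (by linarith)),
    Real.Gamma_add_one hγ.ne']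
  have := (Real.Gamma_pos_of_pos hγ).ne'
  simp [hγ.ne']
  field_simp

lemma locallyIntegrable_rlKernel {γ : ℝ} (hγ : 0 < γ) : LocallyIntegrable (rlKernel γ) := by
  have h0 : ∀ R : ℝ, IntegrableOn (rlKernel γ) (Icc (-R) R) := by
    intro R
    have h1 : IntegrableOn (rlKernel γ) (Iic 0) :=
      (integrableOn_zero).congr_fun (fun t ht => (rlKernel_of_nonpos ht).symm) measurableSet_Iic
    refine (h1.union (integrableOn_rlKernel_Ioc hγ R)).mono_set fun x hx => ?_
    rcases le_or_gt x 0 with h | h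
    · exact Or.inl h
    · exact Or.inr ⟨h, hx.2⟩
  rw [locallyIntegrable_iff]
  intro k hk
  obtain ⟨R, hR⟩ := hk.isBounded.subset_closedBall 0
  rw [Real.closedBall_eq_Icc] at hR
  exact (h0 R).mono_set (by simpa using hR)

/-- Rescaling `t = r s` turns the convolution of two kernels into the Beta integral. The exponent `γ
+ δ - 2` is one short of that of the kernel; the missing factor `r` comes from `dt = r ds`. -/
lemma rlKernel_conv_scaled {γ δ r : ℝ} (hγ : 0 < γ) (hδ : 0 < δ) (hr : 0 < r) (s : ℝ) :
    rlKernel γ (r * s) * rlKernel δ (r - r * s) =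
      r ^ (γ + δ - 2) / Real.Gamma (γ + δ) * ProbabilityTheory.betaPDFReal γ δ s := by
  have hG1 := (Real.Gamma_pos_of_pos hγ).ne'
  have hG2 := (Real.Gamma_pos_of_pos hδ).ne'
  have hG3 := (Real.Gamma_pos_of_pos (add_pos hγ hδ)).ne'
  unfold ProbabilityTheory.betaPDFReal ProbabilityTheory.beta
  split_ifs with h
  · have h1 : 0 < r * s := mul_pos hr h.1
    have h2 : 0 < r - r * s := by nlinarith [h.2]
    rw [rlKernel_of_pos h1, rlKernel_of_pos h2, show r - r * s = r * (1 - s) by ring,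
      Real.mul_rpow hr.le h.1.le, Real.mul_rpow hr.le (by linarith [h.2]),
      show γ + δ - 2 = (γ - 1) + (δ - 1) by ring, Real.rpow_add hr]
    field_simp
  · rw [mul_zero]
    by_cases h0 : 0 < s
    · have h1 : 1 ≤ s := by
        by_contra h1
        exact h ⟨h0, not_le.1 h1⟩
      rw [rlKernel_of_nonpos (γ := δ) (by nlinarith), mul_zero]
    · rw [rlKernel_of_nonpos (γ := γ) (by nlinarith), zero_mul]

lemma integral_betaPDFReal {γ δ : ℝ} (hγ : 0 < γ) (hδ : 0 < δ) :
    Integrable (ProbabilityTheory.betaPDFReal γ δ) ∧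
      ∫ s, ProbabilityTheory.betaPDFReal γ δ s = 1 := by
  have h0 : ∀ s, 0 ≤ ProbabilityTheory.betaPDFReal γ δ s := by
    intro s
    by_cases h : 0 < s ∧ s < 1
    · exact (ProbabilityTheory.betaPDFReal_pos h.1 h.2 hγ hδ).le
    · rw [ProbabilityTheory.betaPDFReal, if_neg h]
  have h1 : ∫⁻ s, ENNReal.ofReal (ProbabilityTheory.betaPDFReal γ δ s) = 1 :=
    ProbabilityTheory.lintegral_betaPDF_eq_one hγ hδ
  have hm := (ProbabilityTheory.measurable_betaPDFReal γ δ).aestronglyMeasurable (μ := volume)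
  constructor
  · refine ⟨hm, ?_⟩
    rw [hasFiniteIntegral_iff_ofReal (ae_of_all _ h0), h1]
    exact ENNReal.one_lt_top
  · rw [integral_eq_lintegral_of_nonneg_ae (ae_of_all _ h0) hm, h1]
    rfl

lemma rlKernel_conv {γ δ : ℝ} (hγ : 0 < γ) (hδ : 0 < δ) (r : ℝ) :
    Integrable (fun t => rlKernel γ t * rlKernel δ (r - t)) ∧
      ∫ t, rlKernel γ t * rlKernel δ (r - t) = rlKernel (γ + δ) r := by
  rcases le_or_gt r 0 with hr | hr
  · have h0 : ∀ t, rlKernel γ t * rlKernel δ (r - t) = 0 := by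
      intro t
      rcases le_or_gt t 0 with ht | ht
      · rw [rlKernel_of_nonpos ht, zero_mul]
      · rw [rlKernel_of_nonpos (γ := δ) (by linarith), mul_zero]
    simp [h0, rlKernel_of_nonpos hr]
  · obtain ⟨hi, he⟩ := integral_betaPDFReal hγ hδ
    have hs : (fun s => rlKernel γ (r * s) * rlKernel δ (r - r * s)) = fun s =>
        r ^ (γ + δ - 2) / Real.Gamma (γ + δ) * ProbabilityTheory.betaPDFReal γ δ s :=
      funext (rlKernel_conv_scaled hγ hδ hr)
    constructor
    · rw [← integrable_comp_mul_left_iff _ hr.ne', hs]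
      exact hi.const_mul _
    · have h1 := Measure.integral_comp_mul_left
        (fun t => rlKernel γ t * rlKernel δ (r - t)) r
      rw [hs, integral_const_mul, he, abs_of_pos (inv_pos.2 hr), smul_eq_mul] at h1
      rw [rlKernel_of_pos hr, show γ + δ - 1 = γ + δ - 2 + 1 by ring, Real.rpow_add_one hr.ne']
      field_simp at h1
      field_simp
      linarith

/-! ### Bounds and Fubini for the fractional integrals -/

section bounds

variable {γ M : ℝ} {f : ℝ → ℝ}

/-- The kernel is singular at `0` and not integrable at infinity, so the bound is split at `t = 1`:
`f` is bounded on the near part, and on the far part the kernel is at most `1 / Γ(γ)` because `γ ≤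
1`. -/
lemma rlKernel_le (hγ : 0 < γ) (hγ1 : γ ≤ 1) (hM : ∀ x, |f x| ≤ M) (x t : ℝ) :
    |rlKernel γ t * f (x + t)| ≤
      (Ioc (0 : ℝ) 1).indicator (fun t => M * rlKernel γ t) t +
        (Real.Gamma γ)⁻¹ * |f (x + t)| := by
  have hG := Real.Gamma_pos_of_pos hγ
  rw [abs_mul, abs_of_nonneg (rlKernel_nonneg hγ t)]
  have h2 : 0 ≤ (Real.Gamma γ)⁻¹ * |f (x + t)| := by positivity
  rcases le_or_gt t 0 with h | h
  · rw [rlKernel_of_nonpos h, indicator_of_notMem (by simp [h]), zero_mul, zero_add]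
    exact h2
  rcases le_or_gt t 1 with h1 | h1
  · rw [indicator_of_mem (show t ∈ Ioc (0 : ℝ) 1 from ⟨h, h1⟩)]
    nlinarith [rlKernel_nonneg hγ t, hM (x + t)]
  · rw [indicator_of_notMem (by simp [h1]), zero_add]
    refine mul_le_mul_of_nonneg_right ?_ (abs_nonneg _)
    rw [rlKernel_of_pos h, div_eq_mul_inv]
    exact mul_le_of_le_one_left (inv_pos.2 hG).le
      (Real.rpow_le_one_of_one_le_of_nonpos h1.le (by linarith))

lemma integrable_rlKernel_bound (hγ : 0 < γ) (hf : Integrable f) (x : ℝ) :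
    Integrable fun t => (Ioc (0 : ℝ) 1).indicator (fun t => M * rlKernel γ t) t +
        (Real.Gamma γ)⁻¹ * |f (x + t)| := by
  refine Integrable.add ?_ ?_
  · rw [integrable_indicator_iff measurableSet_Ioc]
    exact (integrableOn_rlKernel_Ioc hγ 1).const_mul M
  · exact (hf.comp_add_left x).abs.const_mul _

lemma integrable_rlKernel_mul (hγ : 0 < γ) (hγ1 : γ ≤ 1) (hf : Integrable f)
    (hM : ∀ x, |f x| ≤ M) (x : ℝ) : Integrable fun t => rlKernel γ t * f (x + t) :=
  (integrable_rlKernel_bound (M := M) hγ hf x).mono'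
    ((measurable_rlKernel γ).aestronglyMeasurable.mul (hf.comp_add_left x).aestronglyMeasurable)
    (ae_of_all _ (rlKernel_le hγ hγ1 hM x))

/-- Uniformity in `x` is what Fubini needs against a merely integrable `u`. The constants are kept
explicit because they must stay bounded as `γ → 0`, where `1 / Γ(γ) → 0`. -/
lemma integral_abs_rlKernel_mul_le (hγ : 0 < γ) (hγ1 : γ ≤ 1) (hf : Integrable f)
    (hM : ∀ x, |f x| ≤ M) (x : ℝ) :
    ∫ t, |rlKernel γ t * f (x + t)| ≤
      M / Real.Gamma (γ + 1) + (∫ t, |f t|) / Real.Gamma γ := by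
  refine (integral_mono (integrable_rlKernel_mul hγ hγ1 hf hM x).abs
    (integrable_rlKernel_bound (M := M) hγ hf x) (rlKernel_le hγ hγ1 hM x)).trans ?_
  rw [integral_add, integral_indicator measurableSet_Ioc, integral_const_mul, integral_const_mul,
    integral_rlKernel_Ioc hγ zero_le_one, integral_add_left_eq_self (fun t => |f t|) x]
  · rw [Real.one_rpow]
    apply le_of_eq
    ring
  · rw [integrable_indicator_iff measurableSet_Ioc]
    exact (integrableOn_rlKernel_Ioc hγ 1).const_mul M
  · exact (hf.comp_add_left x).abs.const_mul _

lemma abs_rightInt_le (hγ : 0 < γ) (hγ1 : γ ≤ 1) (hf : Integrable f)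
    (hM : ∀ x, |f x| ≤ M) (x : ℝ) :
    |rightInt γ f x| ≤ M / Real.Gamma (γ + 1) + (∫ t, |f t|) / Real.Gamma γ :=
  (abs_integral_le_integral_abs).trans (integral_abs_rlKernel_mul_le hγ hγ1 hf hM x)

end bounds

section fubini

variable {γ M : ℝ} {u ψ : ℝ → ℝ}

lemma integrable_prod_right (hγ : 0 < γ) (hγ1 : γ ≤ 1) (hu : Integrable u) (hψ : Integrable ψ)
    (hM : ∀ x, |ψ x| ≤ M) :
    Integrable fun p : ℝ × ℝ => u p.1 * (rlKernel γ p.2 * ψ (p.1 + p.2)) := by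
  have hm : AEStronglyMeasurable (fun p : ℝ × ℝ => u p.1 * (rlKernel γ p.2 * ψ (p.1 + p.2)))
      (volume.prod volume) := by
    refine hu.1.comp_fst.mul (AEStronglyMeasurable.mul ?_ ?_)
    · exact ((measurable_rlKernel γ).comp measurable_snd).aestronglyMeasurable
    · exact hψ.1.comp_quasiMeasurePreserving (quasiMeasurePreserving_add _ _)
  rw [Measure.volume_eq_prod, integrable_prod_iff hm]
  constructor
  · exact ae_of_all _ fun x => (integrable_rlKernel_mul hγ hγ1 hψ hM x).const_mul (u x)
  · simp only [norm_mul (u _), integral_const_mul]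
    refine (hu.norm.mul_const
      (M / Real.Gamma (γ + 1) + (∫ t, |ψ t|) / Real.Gamma γ)).mono' ?_ ?_
    · have := hm.norm.integral_prod_right'
      simpa only [norm_mul (u _), integral_const_mul] using this
    · refine ae_of_all _ fun x => ?_
      rw [norm_mul, norm_norm]
      refine mul_le_mul_of_nonneg_left ?_ (norm_nonneg _)
      rw [Real.norm_of_nonneg (integral_nonneg fun _ => norm_nonneg _)]
      exact integral_abs_rlKernel_mul_le hγ hγ1 hψ hM x

/-- The measure-preserving shear `(x, t) ↦ (x - t, t)` carries the previous integrand to this one.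
-/
lemma integrable_prod_left (hγ : 0 < γ) (hγ1 : γ ≤ 1) (hu : Integrable u) (hψ : Integrable ψ)
    (hM : ∀ x, |ψ x| ≤ M) :
    Integrable fun p : ℝ × ℝ => (rlKernel γ p.2 * u (p.1 - p.2)) * ψ p.1 := by
  have h := ((measurePreserving_sub_prod (volume : Measure ℝ) (volume : Measure ℝ)).integrable_comp
    (integrable_prod_right hγ hγ1 hu hψ hM).1).2 (integrable_prod_right hγ hγ1 hu hψ hM)
  refine h.congr (ae_of_all _ fun p => ?_)
  simp only [Function.comp, sub_add_cancel]
  ring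

/-- Fractional integration by parts. -/
lemma integral_mul_rightInt (hγ : 0 < γ) (hγ1 : γ ≤ 1) (hu : Integrable u) (hψ : Integrable ψ)
    (hM : ∀ x, |ψ x| ≤ M) :
    ∫ x, u x * rightInt γ ψ x = ∫ x, leftInt γ u x * ψ x := by
  have hR := integrable_prod_right hγ hγ1 hu hψ hM
  have hL := integrable_prod_left hγ hγ1 hu hψ hM
  have h1 : ∫ x, u x * rightInt γ ψ x =
      ∫ p : ℝ × ℝ, u p.1 * (rlKernel γ p.2 * ψ (p.1 + p.2)) := by
    rw [Measure.volume_eq_prod, integral_prod _ hR]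
    simp only [integral_const_mul, rightInt]
  have h2 : ∫ x, leftInt γ u x * ψ x =
      ∫ p : ℝ × ℝ, (rlKernel γ p.2 * u (p.1 - p.2)) * ψ p.1 := by
    rw [Measure.volume_eq_prod, integral_prod _ hL]
    simp only [integral_mul_const, leftInt]
  rw [h1, h2, Measure.volume_eq_prod]
  have hmp := measurePreserving_sub_prod (volume : Measure ℝ) (volume : Measure ℝ)
  have h3 := integral_map (μ := (volume : Measure ℝ).prod volume)
    (f := fun q : ℝ × ℝ => u q.1 * (rlKernel γ q.2 * ψ (q.1 + q.2))) hmp.measurable.aemeasurable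
    (by rw [hmp.map_eq]; exact hR.1)
  rw [hmp.map_eq] at h3
  rw [h3]
  congr 1; ext p
  simp only [sub_add_cancel]
  ring

lemma integrable_leftInt_mul (hγ : 0 < γ) (hγ1 : γ ≤ 1) (hu : Integrable u) (hψ : Integrable ψ)
    (hM : ∀ x, |ψ x| ≤ M) : Integrable fun x => leftInt γ u x * ψ x := by
  have := (integrable_prod_left hγ hγ1 hu hψ hM).integral_prod_left
  simpa only [integral_mul_const, leftInt] using this

end fubini

/-! ### The semigroup property of fractional integration -/

/-- Fractional integrals compose, at a point where the composed kernel is integrable. -/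
lemma rightInt_rightInt {γ δ x : ℝ} {f : ℝ → ℝ} (hγ : 0 < γ) (hδ : 0 < δ)
    (hf : AEStronglyMeasurable f) (hi : Integrable fun t => rlKernel (γ + δ) t * f (x + t)) :
    rightInt γ (rightInt δ f) x = rightInt (γ + δ) f x := by
  have hfx : AEStronglyMeasurable fun r => f (x + r) :=
    hf.comp_quasiMeasurePreserving (measurePreserving_add_left volume x).quasiMeasurePreserving
  have hm : AEStronglyMeasurable
      (fun p : ℝ × ℝ => (rlKernel γ p.2 * rlKernel δ (p.1 - p.2)) * f (x + p.1))
      (volume.prod volume) := by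
    refine AEStronglyMeasurable.mul ?_ hfx.comp_fst
    exact (((measurable_rlKernel γ).comp measurable_snd).mul
      ((measurable_rlKernel δ).comp (measurable_fst.sub measurable_snd))).aestronglyMeasurable
  -- In the coordinate `r = s + t` the inner integral is the convolution of two nonnegative kernels,
  -- so absolute convergence is exactly `hi`.
  have hI : Integrable (fun p : ℝ × ℝ => (rlKernel γ p.2 * rlKernel δ (p.1 - p.2)) * f (x + p.1))
      (volume.prod volume) := by
    rw [integrable_prod_iff hm]
    constructor
    · exact ae_of_all _ fun r => (rlKernel_conv hγ hδ r).1.mul_const (f (x + r))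
    · refine hi.norm.congr (ae_of_all _ fun r => ?_)
      simp only [norm_mul]
      rw [integral_mul_const]
      congr 1
      rw [← (rlKernel_conv hγ hδ r).2, Real.norm_of_nonneg
        (integral_nonneg fun t => mul_nonneg (rlKernel_nonneg hγ _) (rlKernel_nonneg hδ _))]
      congr 1; ext t
      rw [Real.norm_of_nonneg (rlKernel_nonneg hγ _), Real.norm_of_nonneg (rlKernel_nonneg hδ _)]
  have h1 : ∫ r, ∫ t, (rlKernel γ t * rlKernel δ (r - t)) * f (x + r) =
      rightInt (γ + δ) f x := by
    unfold rightInt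
    congr 1; ext r
    rw [integral_mul_const, (rlKernel_conv hγ hδ r).2]
  rw [← h1, integral_integral_swap hI]
  unfold rightInt
  congr 1; ext t
  simp only [mul_assoc]
  rw [integral_const_mul]
  congr 1
  rw [← integral_sub_right_eq_self (fun s => rlKernel δ s * f (x + t + s)) t]
  congr 1; ext r
  congr 2; ring

/-! ### Test functions and classical derivatives -/

section test

variable {Ω : Set ℝ} {φ : ℝ → ℝ}

lemma IsTestFunction.deriv (h : IsTestFunction Ω φ) : IsTestFunction Ω (deriv φ) :=
  ⟨h.1.deriv' , h.2.1.deriv, fun _ hx => h.2.2 (tsupport_deriv_subset hx)⟩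

lemma IsTestFunction.iteratedDeriv (h : IsTestFunction Ω φ) (n : ℕ) :
    IsTestFunction Ω (iteratedDeriv n φ) := by
  induction n with
  | zero => simpa using h
  | succ n ih => rw [iteratedDeriv_succ]; exact ih.deriv

lemma IsTestFunction.continuous (h : IsTestFunction Ω φ) : Continuous φ := h.1.continuous

lemma IsTestFunction.hasDerivAt (h : IsTestFunction Ω φ) (x : ℝ) :
    HasDerivAt φ (_root_.deriv φ x) x :=
  (h.1.differentiable (by simp) x).hasDerivAt

lemma IsTestFunction.integrable (h : IsTestFunction Ω φ) : Integrable φ :=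
  h.continuous.integrable_of_hasCompactSupport h.2.1

lemma IsTestFunction.exists_bound (h : IsTestFunction Ω φ) : ∃ M, 0 ≤ M ∧ ∀ x, |φ x| ≤ M := by
  obtain ⟨M, hM⟩ := h.2.1.exists_bound_of_continuous h.continuous
  exact ⟨M, (norm_nonneg _).trans (hM 0), hM⟩

lemma IsTestFunction.eq_zero (h : IsTestFunction Ω φ) {x : ℝ} (hx : x ∉ Ω) : φ x = 0 :=
  image_eq_zero_of_notMem_tsupport fun h' => hx (h.2.2 h')

lemma IsTestFunction.comp_neg (h : IsTestFunction Ω φ) :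
    IsTestFunction (-Ω) (fun x => φ (-x)) := by
  refine ⟨h.1.comp contDiff_neg, h.2.1.comp_homeomorph (Homeomorph.neg ℝ), ?_⟩
  have := tsupport_comp_eq_preimage φ (Homeomorph.neg ℝ)
  intro x hx
  have hx' : x ∈ tsupport (φ ∘ Homeomorph.neg ℝ) := hx
  rw [this] at hx'
  exact h.2.2 hx'

lemma IsTestFunction.exists_Icc (h : IsTestFunction Ω φ) (hc : Ω.OrdConnected)
    (hn : Ω.Nonempty) : ∃ c d, c ≤ d ∧ Icc c d ⊆ Ω ∧ tsupport φ ⊆ Icc c d := by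
  rcases (tsupport φ).eq_empty_or_nonempty with he | hne
  · obtain ⟨x, hx⟩ := hn
    exact ⟨x, x, le_rfl, by simpa using hx, by simp [he]⟩
  · have hk : IsCompact (tsupport φ) := h.2.1
    obtain ⟨c, hc1, hc2⟩ := hk.exists_isLeast hne
    obtain ⟨d, hd1, hd2⟩ := hk.exists_isGreatest hne
    exact ⟨c, d, hc2 hd1, hc.out (h.2.2 hc1) (h.2.2 hd1), fun x hx => ⟨hc2 hx, hd2 hx⟩⟩

lemma IsTestFunction.exists_abs_bound (h : IsTestFunction Ω φ) :
    ∃ R, 0 < R ∧ ∀ x, R < |x| → φ x = 0 := by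
  obtain ⟨R, hR0, hR⟩ := h.2.1.isCompact.isBounded.subset_closedBall_lt 0 0
  refine ⟨R, hR0, fun x hx => image_eq_zero_of_notMem_tsupport fun h' => ?_⟩
  have := hR h'
  rw [mem_closedBall_zero_iff, Real.norm_eq_abs] at this
  linarith

end test

/-! ### Derivatives of fractional integrals -/

section deriv

variable {Ω : Set ℝ} {φ : ℝ → ℝ} {γ : ℝ}

/-- As a convolution with a locally integrable kernel, the fractional integral can be differentiated
with all derivatives falling on the smooth compactly supported factor. -/
lemma rightInt_eq_convolution (γ : ℝ) (f : ℝ → ℝ) :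
    rightInt γ f = convolution (fun t => rlKernel γ (-t)) f (ContinuousLinearMap.mul ℝ ℝ) := by
  ext x
  rw [convolution_def, rightInt, ← integral_neg_eq_self]
  simp [sub_eq_add_neg]

lemma locallyIntegrable_rlKernel_neg (hγ : 0 < γ) :
    LocallyIntegrable fun t => rlKernel γ (-t) := by
  rw [locallyIntegrable_iff]
  intro k hk
  have h := (locallyIntegrable_rlKernel hγ).integrableOn_isCompact hk.neg
  have := (Measure.measurePreserving_neg (volume : Measure ℝ)).integrableOn_comp_preimage
    (Homeomorph.neg ℝ).measurableEmbedding (f := rlKernel γ) (s := -k)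
  refine (this.2 h).mono_set ?_
  intro x hx
  simpa using hx

lemma hasDerivAt_rightInt (hγ : 0 < γ) (h : IsTestFunction Ω φ) (x : ℝ) :
    HasDerivAt (rightInt γ φ) (rightInt γ (deriv φ) x) x := by
  rw [rightInt_eq_convolution, rightInt_eq_convolution]
  exact h.2.1.hasDerivAt_convolution_right _ (locallyIntegrable_rlKernel_neg hγ)
    (h.1.of_le (by simp)) x

lemma continuous_rightInt (hγ : 0 < γ) (h : IsTestFunction Ω φ) : Continuous (rightInt γ φ) :=
  continuous_iff_continuousAt.2 fun x => (hasDerivAt_rightInt hγ h x).continuousAt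

lemma iteratedDeriv_rightInt (hγ : 0 < γ) (h : IsTestFunction Ω φ) (n : ℕ) :
    iteratedDeriv n (rightInt γ φ) = rightInt γ (iteratedDeriv n φ) := by
  induction n with
  | zero => simp
  | succ n ih =>
    rw [iteratedDeriv_succ, ih, iteratedDeriv_succ]
    ext x
    exact (hasDerivAt_rightInt hγ (h.iteratedDeriv n) x).deriv

lemma rightInt_one (f : ℝ → ℝ) (x : ℝ) : rightInt 1 f x = ∫ t in Ioi x, f t := by
  have h : rightInt 1 f x = ∫ t, (Ioi x).indicator f (x + t) := by
    unfold rightInt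
    congr 1; ext t
    by_cases ht : 0 < t <;> simp [rlKernel_one, ht]
  rw [h, integral_add_left_eq_self (fun t => (Ioi x).indicator f t) x,
    integral_indicator measurableSet_Ioi]

lemma leftInt_one (f : ℝ → ℝ) (x : ℝ) : leftInt 1 f x = ∫ t in Iio x, f t := by
  have h : leftInt 1 f x = ∫ t, (Iio x).indicator f (x - t) := by
    unfold leftInt
    congr 1; ext t
    by_cases ht : 0 < t <;> simp [rlKernel_one, ht]
  rw [h, integral_sub_left_eq_self (fun t => (Iio x).indicator f t) volume x,
    integral_indicator measurableSet_Iio]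

lemma rightInt_one_deriv {g g' : ℝ → ℝ} (hg : ∀ x, HasDerivAt g (g' x) x) (hi : Integrable g')
    (h0 : Tendsto g atTop (𝓝 0)) (x : ℝ) : rightInt 1 g' x = -g x := by
  rw [rightInt_one, integral_Ioi_of_hasDerivAt_of_tendsto' (fun y _ => hg y) hi.integrableOn h0]
  simp

lemma rightInt_eq_zero {f : ℝ → ℝ} {R x : ℝ} (hf : ∀ y, R < y → f y = 0) (hx : R ≤ x) :
    rightInt γ f x = 0 := by
  unfold rightInt
  rw [show (fun t => rlKernel γ t * f (x + t)) = fun _ => 0 from ?_, integral_zero]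
  ext t
  rcases le_or_gt t 0 with ht | ht
  · rw [rlKernel_of_nonpos ht, zero_mul]
  · rw [hf _ (by linarith), mul_zero]

lemma IsTestFunction.tendsto_atTop (h : IsTestFunction Ω φ) : Tendsto φ atTop (𝓝 0) := by
  obtain ⟨R, -, hR⟩ := h.exists_abs_bound
  refine tendsto_const_nhds.congr' ?_
  filter_upwards [eventually_gt_atTop (max R 0)] with x hx
  rw [hR x (lt_of_lt_of_le (lt_of_le_of_lt (le_max_left _ _) hx) (le_abs_self x))]

lemma IsTestFunction.integrable_rlKernel_mul (h : IsTestFunction Ω φ) (hγ : 0 < γ) (x : ℝ) :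
    Integrable fun t => rlKernel γ t * φ (x + t) := by
  have hc : HasCompactSupport fun t => φ (x + t) :=
    h.2.1.comp_homeomorph (Homeomorph.addLeft x)
  have := (locallyIntegrable_rlKernel hγ).integrable_smul_right_of_hasCompactSupport
    (h.continuous.comp (continuous_const.add continuous_id)) hc
  simpa [smul_eq_mul] using this

lemma IsTestFunction.rightInt_rightInt (h : IsTestFunction Ω φ) {δ : ℝ} (hγ : 0 < γ)
    (hδ : 0 < δ) (x : ℝ) : rightInt γ (rightInt δ φ) x = rightInt (γ + δ) φ x :=
  WeakFrac.rightInt_rightInt hγ hδ h.continuous.aestronglyMeasurable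
    (h.integrable_rlKernel_mul (add_pos hγ hδ) x)

/-- `I^{γ+1} = I^γ I^1` and the right integral of order one of `φ'` is `-φ`. -/
lemma IsTestFunction.rightInt_add_one_deriv (h : IsTestFunction Ω φ) (hγ : 0 < γ) (x : ℝ) :
    rightInt (γ + 1) (_root_.deriv φ) x = -rightInt γ φ x := by
  rw [← h.deriv.rightInt_rightInt hγ one_pos,
    show rightInt 1 (_root_.deriv φ) = fun y => -φ y from
      funext (rightInt_one_deriv h.hasDerivAt h.deriv.integrable h.tendsto_atTop)]
  simp [rightInt, integral_neg]

lemma IsTestFunction.abs_rightInt_le (h : IsTestFunction Ω φ) (hγ : 0 < γ) (hγ1 : γ ≤ 1) :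
    ∃ M, 0 ≤ M ∧ ∀ x, |rightInt γ φ x| ≤ M := by
  obtain ⟨M, -, hM⟩ := h.exists_bound
  exact ⟨_, (abs_nonneg _).trans (WeakFrac.abs_rightInt_le hγ hγ1 h.integrable hM 0),
    WeakFrac.abs_rightInt_le hγ hγ1 h.integrable hM⟩

end deriv

/-! ### The classical fractional derivatives of test functions -/

section classical

variable {Ω : Set ℝ} {φ : ℝ → ℝ} {α : ℝ}

lemma fracIntegral_right (σ : ℝ) (f : ℝ → ℝ) : fracIntegral .right σ f = rightInt σ f := by
  ext x
  have h : ∀ t, rlKernel σ t * f (x + t) =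
      (Real.Gamma σ)⁻¹ * (Ioi x).indicator (fun y => f y / (y - x) ^ (1 - σ)) (x + t) := by
    intro t
    by_cases ht : 0 < t
    · rw [rlKernel_of_pos ht, indicator_of_mem (by simpa using ht), add_sub_cancel_left,
        show σ - 1 = -(1 - σ) by ring, Real.rpow_neg ht.le]
      ring
    · rw [rlKernel_of_nonpos (not_lt.1 ht), indicator_of_notMem (by simpa using ht)]
      simp
  unfold rightInt
  simp only [h]
  rw [integral_const_mul, integral_add_left_eq_self
    (fun t => (Ioi x).indicator (fun y => f y / (y - x) ^ (1 - σ)) t) x,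
    integral_indicator measurableSet_Ioi]
  rfl

lemma fracIntegral_left (σ : ℝ) (f : ℝ → ℝ) (x : ℝ) :
    fracIntegral .left σ f x = fracIntegral .right σ (fun y => f (-y)) (-x) := by
  simp only [fracIntegral]
  rw [← integral_indicator measurableSet_Iio, ← integral_indicator measurableSet_Ioi,
    ← integral_neg_eq_self]
  congr 2
  ext y
  by_cases hy : -x < y
  · rw [indicator_of_mem (show -y ∈ Iio x by simpa using neg_lt.1 hy),
      indicator_of_mem (by exact hy)]
    ring_nf
  · rw [indicator_of_notMem (fun h : -y ∈ Iio x => hy (neg_lt.1 h)),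
      indicator_of_notMem (by exact hy)]

lemma floor_add_one_sub_pos (α : ℝ) : 0 < (⌊α⌋₊ : ℝ) + 1 - α := by
  linarith [Nat.lt_floor_add_one α]

lemma floor_add_one_sub_lt_one (hα : 0 ≤ α) (h : (⌊α⌋₊ : ℝ) ≠ α) :
    (⌊α⌋₊ : ℝ) + 1 - α < 1 := by
  have := lt_of_le_of_ne (Nat.floor_le hα) h
  linarith

lemma classicalDeriv_right (h : (⌊α⌋₊ : ℝ) ≠ α) (hφ : IsTestFunction Ω φ) (x : ℝ) :
    classicalDeriv .right α φ x = (-1) ^ (⌊α⌋₊ + 1) *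
      rightInt ((⌊α⌋₊ : ℝ) + 1 - α) (iteratedDeriv (⌊α⌋₊ + 1) φ) x := by
  rw [classicalDeriv, if_neg h, fracIntegral_right,
    iteratedDeriv_rightInt (floor_add_one_sub_pos α) hφ]
  rfl

/-- The sign `(-1)^n` built into the right derivative is the one created by differentiating a
reflected function `n` times. At integer orders no such sign is built in, and the identity fails for
odd ones. -/
lemma classicalDeriv_left (h : (⌊α⌋₊ : ℝ) ≠ α) (φ : ℝ → ℝ) (x : ℝ) :
    classicalDeriv .left α φ x = classicalDeriv .right α (fun y => φ (-y)) (-x) := by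
  rw [classicalDeriv, if_neg h, classicalDeriv, if_neg h,
    show fracIntegral .left ((⌊α⌋₊ : ℝ) + 1 - α) φ = fun y =>
      fracIntegral .right ((⌊α⌋₊ : ℝ) + 1 - α) (fun y => φ (-y)) (-y) from
      funext (fracIntegral_left _ _), iteratedDeriv_comp_neg]
  simp [Side.sign]

lemma classicalDeriv_natCast (s : Side) (h : (⌊α⌋₊ : ℝ) = α) (φ : ℝ → ℝ) :
    classicalDeriv s α φ = iteratedDeriv ⌊α⌋₊ φ := by
  ext x
  rw [classicalDeriv, if_pos h]

end classical

/-! ### Uniformly locally integrable functions -/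

/-- Local integrability with bounds that are uniform under translations. -/
def UnifLocIntegrable (f : ℝ → ℝ) : Prop :=
  LocallyIntegrable f ∧ ∀ R, ∃ C, ∀ z, ∫ x in Icc (z - R) (z + R), |f x| ≤ C

lemma _root_.MeasureTheory.Integrable.unifLocIntegrable {f : ℝ → ℝ} (hf : Integrable f) :
    UnifLocIntegrable f :=
  ⟨hf.locallyIntegrable, fun _ => ⟨∫ x, |f x|, fun _ =>
    setIntegral_le_integral hf.abs (ae_of_all _ fun _ => abs_nonneg _)⟩⟩

lemma unifLocIntegrable_const (c : ℝ) : UnifLocIntegrable fun _ => c := by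
  refine ⟨locallyIntegrable_const c, fun R => ⟨max (2 * R) 0 * |c|, fun z => ?_⟩⟩
  rw [setIntegral_const, smul_eq_mul, Measure.real, Real.volume_Icc, ENNReal.toReal_ofReal']
  apply le_of_eq
  congr 2; ring

lemma abs_leftInt_le (γ : ℝ) (hγ : 0 < γ) (u : ℝ → ℝ) (x : ℝ) :
    |leftInt γ u x| ≤ leftInt γ (fun y => |u y|) x := by
  refine (abs_integral_le_integral_abs).trans (le_of_eq ?_)
  unfold leftInt
  congr 1; ext t
  rw [abs_mul, abs_of_nonneg (rlKernel_nonneg hγ t)]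

/-- The fractional integral of an integrable function need not be integrable on the line, but its
mass on windows of fixed length is bounded: by duality that mass is at most the pairing of `|u|`
with the right integral of the window's indicator, which is bounded in terms of the window's length
alone. -/
lemma UnifLocIntegrable.leftInt {u : ℝ → ℝ} {γ : ℝ} (hγ : 0 < γ) (hγ1 : γ ≤ 1)
    (hu : Integrable u) : UnifLocIntegrable (leftInt γ u) := by
  have hind : ∀ a b : ℝ, Integrable ((Icc a b).indicator fun _ => (1 : ℝ)) := fun a b => by
    rw [integrable_indicator_iff measurableSet_Icc]
    exact integrableOn_const (by simp)
  have hbd : ∀ a b x : ℝ, |(Icc a b).indicator (fun _ => (1 : ℝ)) x| ≤ 1 := fun a b x => by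
    by_cases h : x ∈ Icc a b <;> simp [h]
  have hmul : ∀ (g : ℝ → ℝ) (a b : ℝ), (fun x => g x * (Icc a b).indicator (fun _ => (1 : ℝ)) x) =
      (Icc a b).indicator g := fun g a b => by
    ext x
    by_cases h : x ∈ Icc a b <;> simp [h]
  have hint : ∀ v : ℝ → ℝ, Integrable v → ∀ a b, IntegrableOn (WeakFrac.leftInt γ v) (Icc a b) := by
    intro v hv a b
    have := integrable_leftInt_mul hγ hγ1 hv (hind a b) (hbd a b)
    rwa [hmul, integrable_indicator_iff measurableSet_Icc] at this
  constructor
  · rw [locallyIntegrable_iff]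
    intro k hk
    obtain ⟨R, hR⟩ := hk.isBounded.subset_closedBall 0
    rw [Real.closedBall_eq_Icc] at hR
    exact (hint u hu _ _).mono_set hR
  · intro R
    refine ⟨∫ x, |u x| * (1 / Real.Gamma (γ + 1) + max (2 * R) 0 / Real.Gamma γ), fun z => ?_⟩
    have h1 : ∫ x in Icc (z - R) (z + R), |WeakFrac.leftInt γ u x| ≤
        ∫ x in Icc (z - R) (z + R), WeakFrac.leftInt γ (fun y => |u y|) x :=
      integral_mono (hint u hu _ _).abs (hint _ hu.abs _ _) fun x => abs_leftInt_le γ hγ u x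
    refine h1.trans ?_
    rw [← integral_indicator measurableSet_Icc, ← hmul,
      ← integral_mul_rightInt hγ hγ1 hu.abs (hind _ _) (hbd _ _)]
    refine integral_mono_of_nonneg (ae_of_all _ fun x => ?_) (hu.abs.mul_const _)
      (ae_of_all _ fun x => ?_)
    · refine mul_nonneg (abs_nonneg _) (integral_nonneg fun t => ?_)
      exact mul_nonneg (rlKernel_nonneg hγ t) (indicator_nonneg (fun _ _ => zero_le_one) _)
    · refine mul_le_mul_of_nonneg_left ((le_abs_self _).trans
        ((abs_rightInt_le hγ hγ1 (hind _ _) (hbd _ _) x).trans (le_of_eq ?_))) (abs_nonneg _)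
      congr 2
      have : ∀ t, |(Icc (z - R) (z + R)).indicator (fun _ => (1 : ℝ)) t| =
          (Icc (z - R) (z + R)).indicator (fun _ => (1 : ℝ)) t := fun t =>
        abs_of_nonneg (indicator_nonneg (fun _ _ => zero_le_one) _)
      simp only [this]
      rw [integral_indicator measurableSet_Icc, setIntegral_const, smul_eq_mul, mul_one,
        Measure.real, Real.volume_Icc, ENNReal.toReal_ofReal']
      congr 1; ring

/-! ### Domains, pairings and reflection -/

lemma IsDomain.isOpen {Ω : Set ℝ} (h : IsDomain Ω) : IsOpen Ω := by
  rcases h with rfl | ⟨a, b, -, rfl⟩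
  exacts [isOpen_univ, isOpen_Ioo]

lemma IsDomain.ordConnected {Ω : Set ℝ} (h : IsDomain Ω) : Ω.OrdConnected := by
  rcases h with rfl | ⟨a, b, -, rfl⟩
  exacts [ordConnected_univ, ordConnected_Ioo]

lemma IsDomain.nonempty {Ω : Set ℝ} (h : IsDomain Ω) : Ω.Nonempty := by
  rcases h with rfl | ⟨a, b, hab, rfl⟩
  exacts [univ_nonempty, nonempty_Ioo.2 hab]

lemma IsDomain.neg {Ω : Set ℝ} (h : IsDomain Ω) : IsDomain (-Ω) := by
  rcases h with rfl | ⟨a, b, hab, rfl⟩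
  · exact Or.inl (by simp)
  · exact Or.inr ⟨-b, -a, by linarith, by simp⟩

section pairing

variable {Ω : Set ℝ} {φ v w : ℝ → ℝ}

lemma integrableOn_mul_test (hv : LocallyIntegrableOn v Ω) (hφ : IsTestFunction Ω φ) :
    IntegrableOn (fun x => v x * φ x) Ω := by
  have h1 : IntegrableOn v (tsupport φ) := hv.integrableOn_compact_subset hφ.2.2 hφ.2.1
  have h2 : IntegrableOn (fun x => v x * φ x) (tsupport φ) :=
    h1.mul_continuousOn hφ.continuous.continuousOn hφ.2.1
  refine ((integrableOn_iff_integrable_of_support_subset fun x hx => ?_).1 h2).integrableOn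
  by_contra hx'
  exact hx (by simp [image_eq_zero_of_notMem_tsupport hx'])

lemma locallyIntegrableOn_const_mul (hv : LocallyIntegrableOn v Ω) (c : ℝ) :
    LocallyIntegrableOn (fun x => c * v x) Ω := fun x hx => by
  obtain ⟨t, ht, hi⟩ := hv x hx
  exact ⟨t, ht, hi.const_mul c⟩

lemma setIntegral_mul_test (hφ : IsTestFunction Ω φ) (v : ℝ → ℝ) :
    ∫ x in Ω, v x * φ x = ∫ x, v x * φ x :=
  setIntegral_eq_integral_of_forall_compl_eq_zero fun x hx => by rw [hφ.eq_zero hx, mul_zero]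

lemma setIntegral_mul_eq_indicator (hΩ : MeasurableSet Ω) (u g : ℝ → ℝ) :
    ∫ x in Ω, u x * g x = ∫ x, Ω.indicator u x * g x := by
  rw [← integral_indicator hΩ]
  congr 1; ext x
  by_cases h : x ∈ Ω <;> simp [h]

lemma ae_eq_of_integral_test_eq (hΩ : IsOpen Ω) (hv : LocallyIntegrableOn v Ω)
    (hw : LocallyIntegrableOn w Ω)
    (h : ∀ φ, IsTestFunction Ω φ → ∫ x in Ω, v x * φ x = ∫ x in Ω, w x * φ x) :
    ∀ᵐ x, x ∈ Ω → v x = w x := by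
  have := hΩ.ae_eq_zero_of_integral_contDiff_smul_eq_zero (hv.sub hw) fun g hg1 hg2 hg3 => by
    have hg : IsTestFunction Ω g := ⟨hg1, hg2, hg3⟩
    have h1 := h g hg
    have h2 : ∫ x in Ω, (v - w) x * g x = 0 := by
      simp only [Pi.sub_apply, sub_mul]
      rw [integral_sub (integrableOn_mul_test hv hg) (integrableOn_mul_test hw hg), h1, sub_self]
    rw [setIntegral_mul_test hg] at h2
    simpa [mul_comm] using h2
  filter_upwards [this] with x hx hxΩ
  exact sub_eq_zero.1 (hx hxΩ)

lemma setIntegral_comp_neg (Ω : Set ℝ) (f : ℝ → ℝ) :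
    ∫ x in -Ω, f (-x) = ∫ x in Ω, f x := by
  have := (Measure.measurePreserving_neg (volume : Measure ℝ)).setIntegral_preimage_emb
    (Homeomorph.neg ℝ).measurableEmbedding f Ω
  exact this

lemma integrableOn_comp_neg {s : Set ℝ} {f : ℝ → ℝ} (hf : IntegrableOn f s) :
    IntegrableOn (fun x => f (-x)) (-s) :=
  ((Measure.measurePreserving_neg (volume : Measure ℝ)).integrableOn_comp_preimage
    (Homeomorph.neg ℝ).measurableEmbedding (f := f) (s := s)).2 hf

lemma locallyIntegrableOn_comp_neg (hΩ : IsOpen Ω) (hv : LocallyIntegrableOn v Ω) :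
    LocallyIntegrableOn (fun x => v (-x)) (-Ω) := by
  rw [locallyIntegrableOn_iff hΩ.neg.isLocallyClosed]
  intro k hk hkc
  have := integrableOn_comp_neg
    (hv.integrableOn_compact_subset (t := -k) (by simpa using neg_subset_neg.2 hk) hkc.neg)
  rwa [neg_neg] at this

end pairing

section reflection

variable {Ω : Set ℝ} {α : ℝ} {u v w : ℝ → ℝ}

lemma IsWeakDeriv.comp_neg {n : ℕ} (hΩ : IsOpen Ω) (h : IsWeakDeriv Ω n w v) :
    IsWeakDeriv (-Ω) n (fun x => w (-x)) (fun x => (-1) ^ n * v (-x)) := by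
  refine ⟨locallyIntegrableOn_comp_neg hΩ h.1,
    locallyIntegrableOn_const_mul (locallyIntegrableOn_comp_neg hΩ h.2.1) _, fun φ hφ => ?_⟩
  have hφ' : IsTestFunction Ω fun x => φ (-x) := by simpa using hφ.comp_neg
  have h1 := h.2.2 _ hφ'
  rw [← setIntegral_comp_neg, ← setIntegral_comp_neg Ω] at h1
  simp only [iteratedDeriv_comp_neg, neg_neg, smul_eq_mul] at h1
  simp only [mul_assoc]
  rw [integral_const_mul, h1]
  congr 1
  rw [← integral_const_mul]
  congr 1; ext x
  rw [mul_left_comm, ← mul_assoc ((-1 : ℝ) ^ n) ((-1) ^ n), ← pow_add, Even.neg_one_pow ⟨n, rfl⟩,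
    one_mul]

lemma IsWeakFracDeriv.comp_neg {s : Side} (hΩ : IsOpen Ω) (hα : (⌊α⌋₊ : ℝ) ≠ α)
    (h : IsWeakFracDeriv s Ω α u v) :
    IsWeakFracDeriv s.opp (-Ω) α (fun x => u (-x)) (fun x => v (-x)) := by
  refine ⟨integrableOn_comp_neg h.1, locallyIntegrableOn_comp_neg hΩ h.2.1, fun φ hφ => ?_⟩
  have hφ' : IsTestFunction Ω fun x => φ (-x) := by simpa using hφ.comp_neg
  have h1 := h.2.2 _ hφ'
  rw [← setIntegral_comp_neg, ← setIntegral_comp_neg Ω] at h1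
  simp only [neg_neg] at h1
  rw [h1]
  congr 2; ext x
  cases s
  · simp only [Side.opp]
    rw [classicalDeriv_left hα]
  · simp only [Side.opp]
    rw [classicalDeriv_left hα]
    simp

lemma isWeakFracDeriv_right_iff (hΩ : IsOpen Ω) (hα : (⌊α⌋₊ : ℝ) ≠ α) :
    IsWeakFracDeriv .right Ω α u v ↔
      IsWeakFracDeriv .left (-Ω) α (fun x => u (-x)) (fun x => v (-x)) := by
  refine ⟨fun h => h.comp_neg hΩ hα, fun h => ?_⟩
  simpa [Side.opp] using h.comp_neg hΩ.neg hα

/-- The sign `(-1)^[α]` of the definition and `(-1)^([α]+1)` of the classical derivative always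
combine to `-1`. -/
lemma isWeakFracDeriv_left_iff (hα : (⌊α⌋₊ : ℝ) ≠ α) :
    IsWeakFracDeriv .left Ω α u v ↔ IntegrableOn u Ω ∧ LocallyIntegrableOn v Ω ∧
      ∀ φ, IsTestFunction Ω φ → ∫ x in Ω, v x * φ x =
        -∫ x in Ω, u x * rightInt ((⌊α⌋₊ : ℝ) + 1 - α) (iteratedDeriv (⌊α⌋₊ + 1) φ) x := by
  unfold IsWeakFracDeriv
  refine and_congr_right fun _ => and_congr_right fun _ => forall_congr' fun φ =>
    forall_congr' fun hφ => ?_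
  have : (-1 : ℝ) ^ ⌊α⌋₊ * ∫ x in Ω, u x * classicalDeriv .right α φ x =
      -∫ x in Ω, u x * rightInt ((⌊α⌋₊ : ℝ) + 1 - α) (iteratedDeriv (⌊α⌋₊ + 1) φ) x := by
    simp only [classicalDeriv_right hα hφ, mul_left_comm (u _)]
    rw [integral_const_mul, ← mul_assoc, ← pow_add,
      show ⌊α⌋₊ + (⌊α⌋₊ + 1) = 2 * ⌊α⌋₊ + 1 by ring, Odd.neg_one_pow ⟨_, rfl⟩, neg_one_mul]
  simp only [Side.opp]
  rw [this]

end reflection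

/-! ### Primitives and the lemma of du Bois-Reymond -/

section dubois

variable {Ω : Set ℝ} {φ J v w : ℝ → ℝ}

lemma IsTestFunction.sub_mul (hφ : IsTestFunction Ω φ) {χ : ℝ → ℝ} (hχ : IsTestFunction Ω χ)
    (c : ℝ) : IsTestFunction Ω (fun x => φ x - c * χ x) := by
  refine ⟨hφ.1.sub (contDiff_const.mul hχ.1), hφ.2.1.sub (hχ.2.1.mul_left), ?_⟩
  refine (tsupport_sub φ (fun x => c * χ x)).trans (union_subset hφ.2.2 ?_)
  exact (closure_mono fun x hx => right_ne_zero_of_mul hx).trans hχ.2.2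

lemma exists_test_integral_one (hΩ : IsOpen Ω) (hn : Ω.Nonempty) :
    ∃ χ, IsTestFunction Ω χ ∧ ∫ x, χ x = 1 := by
  obtain ⟨x, hx⟩ := hn
  obtain ⟨r, hr, hb⟩ := Metric.nhds_basis_closedBall.mem_iff.1 (hΩ.mem_nhds hx)
  let f : ContDiffBump x := ⟨r / 2, r, by positivity, by linarith⟩
  refine ⟨f.normed volume, ⟨f.contDiff_normed, f.hasCompactSupport_normed, ?_⟩, f.integral_normed⟩
  rw [f.tsupport_normed_eq]
  exact hb

/-- The primitive starting at the left end of a compact interval around the support vanishes beyond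
the right end precisely because the total integral is zero. -/
lemma IsTestFunction.exists_primitive (hc : Ω.OrdConnected) (hn : Ω.Nonempty)
    (hφ : IsTestFunction Ω φ) (h0 : ∫ x, φ x = 0) :
    ∃ χ, IsTestFunction Ω χ ∧ _root_.deriv χ = φ := by
  obtain ⟨c, d, hcd, hΩ, hs⟩ := hφ.exists_Icc hc hn
  have hz : ∀ x, x ∉ Icc c d → φ x = 0 := fun x hx =>
    image_eq_zero_of_notMem_tsupport fun h => hx (hs h)
  have hd : ∀ x, HasDerivAt (fun y => ∫ t in c..y, φ t) (φ x) x := fun x =>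
    hφ.continuous.integral_hasStrictDerivAt c x |>.hasDerivAt
  have hderiv : _root_.deriv (fun y => ∫ t in c..y, φ t) = φ := funext fun x => (hd x).deriv
  have hsupp : ∀ x, x ∉ Icc c d → ∫ t in c..x, φ t = 0 := by
    intro x hx
    rcases lt_or_ge x c with h | h
    · rw [intervalIntegral.integral_of_ge h.le, integral_Ioc_eq_integral_Ioo,
        setIntegral_eq_zero_of_forall_eq_zero, neg_zero]
      exact fun t ht => hz t fun h' => absurd h'.1 (not_le.2 ht.2)
    · have hxd : d < x := not_le.1 fun h' => hx ⟨h, h'⟩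
      rw [intervalIntegral.integral_of_le h, ← integral_Icc_eq_integral_Ioc,
        setIntegral_eq_integral_of_forall_compl_eq_zero, h0]
      exact fun t ht => hz t fun h' => ht ⟨h'.1, h'.2.trans hxd.le⟩
  have hsub : tsupport (fun y => ∫ t in c..y, φ t) ⊆ Icc c d :=
    closure_minimal (fun x hx => by_contra fun h => hx (hsupp x h)) isClosed_Icc
  refine ⟨fun y => ∫ t in c..y, φ t, ⟨?_, ?_, hsub.trans hΩ⟩, hderiv⟩
  · rw [contDiff_infty_iff_deriv, hderiv]
    exact ⟨fun x => (hd x).differentiableAt, hφ.1⟩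
  · exact isCompact_Icc.of_isClosed_subset (isClosed_tsupport _) hsub

/-- A linear functional on test functions that kills derivatives is a multiple of the integral. -/
lemma exists_const_of_forall_deriv_eq_zero (hΩ : IsOpen Ω) (hc : Ω.OrdConnected)
    (hn : Ω.Nonempty) (T : (ℝ → ℝ) → ℝ)
    (hT : ∀ φ χ, IsTestFunction Ω φ → IsTestFunction Ω χ → ∀ c : ℝ,
      T (fun x => φ x - c * χ x) = T φ - c * T χ)
    (h0 : ∀ φ, IsTestFunction Ω φ → T (deriv φ) = 0) :
    ∃ C, ∀ φ, IsTestFunction Ω φ → T φ = C * ∫ x, φ x := by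
  obtain ⟨χ, hχ, hχ1⟩ := exists_test_integral_one hΩ hn
  refine ⟨T χ, fun φ hφ => ?_⟩
  -- Removing the multiple `∫ φ` of `χ`, which has integral one, leaves a function of integral zero,
  -- that is, the derivative of a test function.
  have hi : ∫ x, (φ x - (∫ y, φ y) * χ x) = 0 := by
    rw [integral_sub hφ.integrable (hχ.integrable.const_mul _), integral_const_mul, hχ1]
    ring
  obtain ⟨ψ, hψ, hd⟩ := (hφ.sub_mul hχ (∫ y, φ y)).exists_primitive hc hn hi
  have := h0 ψ hψ
  rw [hd, hT φ χ hφ hχ] at this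
  linarith

lemma intervalIntegrable_of_mem (hc : Ω.OrdConnected) (hw : LocallyIntegrableOn w Ω) {x y : ℝ}
    (hx : x ∈ Ω) (hy : y ∈ Ω) : IntervalIntegrable w volume x y :=
  (hw.integrableOn_compact_subset (hc.uIcc_subset hx hy) isCompact_uIcc).intervalIntegrable

lemma continuousOn_primitive (hΩ : IsOpen Ω) (hc : Ω.OrdConnected)
    (hw : LocallyIntegrableOn w Ω) {x₀ : ℝ} (hx₀ : x₀ ∈ Ω) :
    ContinuousOn (fun x => ∫ t in x₀..x, w t) Ω := by
  intro x hx
  obtain ⟨r, hr, hb⟩ := Metric.nhds_basis_closedBall.mem_iff.1 (hΩ.mem_nhds hx)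
  rw [Real.closedBall_eq_Icc] at hb
  have h1 : x - r ∈ Ω := hb ⟨le_rfl, by linarith⟩
  have h2 : x + r ∈ Ω := hb ⟨by linarith, le_rfl⟩
  have h3 : IntervalIntegrable w volume (x - r) (x + r) := intervalIntegrable_of_mem hc hw h1 h2
  have h4 := intervalIntegral.continuousOn_primitive_interval' h3 (a := x)
    (by rw [uIcc_of_le (by linarith)]; constructor <;> linarith)
  have h5 : ContinuousAt (fun y => ∫ t in x..y, w t) x := by
    refine h4.continuousAt ?_
    rw [uIcc_of_le (by linarith)]
    exact Icc_mem_nhds (by linarith) (by linarith)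
  refine ContinuousAt.continuousWithinAt ?_
  refine (h5.const_add (∫ t in x₀..x, w t)).congr ?_
  filter_upwards [hΩ.mem_nhds hx] with y hy
  exact intervalIntegral.integral_add_adjacent_intervals
    (intervalIntegrable_of_mem hc hw hx₀ hx) (intervalIntegrable_of_mem hc hw hx hy)

lemma locallyIntegrableOn_primitive (hΩ : IsOpen Ω) (hc : Ω.OrdConnected)
    (hw : LocallyIntegrableOn w Ω) {x₀ : ℝ} (hx₀ : x₀ ∈ Ω) :
    LocallyIntegrableOn (fun x => ∫ t in x₀..x, w t) Ω :=
  (continuousOn_primitive hΩ hc hw hx₀).locallyIntegrableOn hΩ.measurableSet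

lemma IsTestFunction.integral_deriv (hφ : IsTestFunction Ω φ) : ∫ x, _root_.deriv φ x = 0 :=
  integral_eq_zero_of_hasDerivAt_of_integrable hφ.hasDerivAt hφ.deriv.integrable hφ.integrable

lemma IsTestFunction.rightInt_one_deriv (hφ : IsTestFunction Ω φ) (x : ℝ) :
    rightInt 1 (_root_.deriv φ) x = -φ x :=
  WeakFrac.rightInt_one_deriv hφ.hasDerivAt hφ.deriv.integrable hφ.tendsto_atTop x

/-- Integration by parts for primitives. -/
lemma integral_primitive_mul_deriv (hc : Ω.OrdConnected)
    (hw : LocallyIntegrableOn w Ω) {x₀ : ℝ} (hx₀ : x₀ ∈ Ω) (hφ : IsTestFunction Ω φ) :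
    ∫ x in Ω, (∫ t in x₀..x, w t) * deriv φ x = -∫ x in Ω, w x * φ x := by
  obtain ⟨c, d, hcd, hΩ', hs⟩ := hφ.exists_Icc hc ⟨x₀, hx₀⟩
  have hcΩ : c ∈ Ω := hΩ' ⟨le_rfl, hcd⟩
  have hz : ∀ x, x ∉ Icc c d → φ x = 0 := fun x hx =>
    image_eq_zero_of_notMem_tsupport fun h => hx (hs h)
  have hz' : ∀ x, x ∉ Icc c d → deriv φ x = 0 := fun x hx =>
    image_eq_zero_of_notMem_tsupport fun h => hx (hs (tsupport_deriv_subset h))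
  have hwi : IntegrableOn w (Icc c d) := hw.integrableOn_compact_subset hΩ' isCompact_Icc
  have hwi' : Integrable ((Icc c d).indicator w) := by
    rwa [integrable_indicator_iff measurableSet_Icc]
  obtain ⟨M, -, hM⟩ := hφ.deriv.exists_bound
  -- Integration by parts is the adjointness of `I^1`, applied to `w` cut off to the interval
  -- carrying `φ`.
  have hF := integral_mul_rightInt one_pos le_rfl hwi' hφ.deriv.integrable hM
  simp only [hφ.rightInt_one_deriv, mul_neg] at hF
  rw [integral_neg] at hF
  have h1 : ∫ x, (Icc c d).indicator w x * φ x = ∫ x in Ω, w x * φ x := by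
    rw [setIntegral_mul_test hφ]
    congr 1; ext x
    by_cases h : x ∈ Icc c d
    · rw [indicator_of_mem h]
    · rw [hz x h, mul_zero, mul_zero]
  -- On that interval the two primitives differ by a constant, and constants pair to zero with `φ'`.
  have h2 : ∀ x, (∫ t in x₀..x, w t) * deriv φ x =
      leftInt 1 ((Icc c d).indicator w) x * deriv φ x + (∫ t in x₀..c, w t) * deriv φ x := by
    intro x
    by_cases h : x ∈ Icc c d
    · rw [← add_mul]
      congr 1
      rw [leftInt_one, ← intervalIntegral.integral_add_adjacent_intervals
        (intervalIntegrable_of_mem hc hw hx₀ hcΩ) (intervalIntegrable_of_mem hc hw hcΩ (hΩ' h)),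
        add_comm, intervalIntegral.integral_of_le h.1, ← integral_Icc_eq_integral_Ioc,
        integral_Icc_eq_integral_Ico, setIntegral_indicator measurableSet_Icc]
      congr 3
      ext y
      exact ⟨fun hy => ⟨hy.2, hy.1, hy.2.le.trans h.2⟩, fun hy => ⟨hy.2.1, hy.1⟩⟩
    · rw [hz' x h, mul_zero, mul_zero, mul_zero, add_zero]
  rw [setIntegral_mul_test hφ.deriv]
  simp only [h2]
  rw [integral_add (integrable_leftInt_mul one_pos le_rfl hwi' hφ.deriv.integrable hM)
    (hφ.deriv.integrable.const_mul _), integral_const_mul, hφ.integral_deriv, mul_zero, add_zero,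
    ← hF, h1]

lemma isWeakDeriv_one_iff :
    IsWeakDeriv Ω 1 J w ↔ LocallyIntegrableOn J Ω ∧ LocallyIntegrableOn w Ω ∧
      ∀ φ, IsTestFunction Ω φ → ∫ x in Ω, w x * φ x = -∫ x in Ω, J x * deriv φ x := by
  simp [IsWeakDeriv, iteratedDeriv_one]

lemma integral_test_sub_mul (hJ : LocallyIntegrableOn J Ω) (hφ : IsTestFunction Ω φ)
    {χ : ℝ → ℝ} (hχ : IsTestFunction Ω χ) (c : ℝ) :
    ∫ x in Ω, J x * (φ x - c * χ x) =
      (∫ x in Ω, J x * φ x) - c * ∫ x in Ω, J x * χ x := by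
  rw [← integral_const_mul, ← integral_sub (integrableOn_mul_test hJ hφ)
    ((integrableOn_mul_test hJ hχ).const_mul c)]
  congr 1; ext x; ring

/-- If a distributional derivative of order `m + 1` is locally integrable, so is the one of
order `m`. -/
lemma exists_lower_deriv (hΩ : IsOpen Ω) (hc : Ω.OrdConnected) (hn : Ω.Nonempty)
    (hJ : LocallyIntegrableOn J Ω) (hv : LocallyIntegrableOn v Ω) (m : ℕ)
    (h : ∀ φ, IsTestFunction Ω φ →
      ∫ x in Ω, J x * iteratedDeriv (m + 1) φ x = ∫ x in Ω, v x * φ x) :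
    ∃ w, LocallyIntegrableOn w Ω ∧ ∀ φ, IsTestFunction Ω φ →
      ∫ x in Ω, J x * iteratedDeriv m φ x = ∫ x in Ω, w x * φ x := by
  obtain ⟨x₀, hx₀⟩ := hn
  have hV := locallyIntegrableOn_primitive hΩ hc hv hx₀
  -- With `V` a primitive of `v`, the functional `φ ↦ ∫ J φ^(m) + ∫ V φ` kills derivatives, because
  -- `∫ V φ' = -∫ v φ`. It is therefore integration against a constant `C`, and `w = C - V`.
  obtain ⟨C, hC⟩ := exists_const_of_forall_deriv_eq_zero hΩ hc ⟨x₀, hx₀⟩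
    (fun ψ => (∫ x in Ω, J x * iteratedDeriv m ψ x) + ∫ x in Ω, (∫ t in x₀..x, v t) * ψ x)
    (fun φ χ hφ hχ c => by
      have h1 : iteratedDeriv m (fun x => φ x - c * χ x) =
          fun x => iteratedDeriv m φ x - c * iteratedDeriv m χ x := by
        ext x
        have ha : ContDiffAt ℝ m φ x := (hφ.1.of_le (by exact_mod_cast le_top)).contDiffAt
        have hb : ContDiffAt ℝ m χ x := (hχ.1.of_le (by exact_mod_cast le_top)).contDiffAt
        rw [iteratedDeriv_fun_sub ha (contDiffAt_const.mul hb), iteratedDeriv_const_mul_field]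
      simp only [h1]
      rw [integral_test_sub_mul hJ (hφ.iteratedDeriv m) (hχ.iteratedDeriv m),
        integral_test_sub_mul hV hφ hχ]
      ring)
    (fun φ hφ => by
      simp only [← iteratedDeriv_succ']
      rw [h φ hφ, integral_primitive_mul_deriv hc hv hx₀ hφ]
      ring)
  refine ⟨fun x => C - ∫ t in x₀..x, v t, (locallyIntegrableOn_const C).sub hV, fun φ hφ => ?_⟩
  have h1 := hC φ hφ
  simp only [_root_.sub_mul]
  rw [integral_sub (hφ.integrable.integrableOn.const_mul C) (integrableOn_mul_test hV hφ),
    setIntegral_mul_test hφ, integral_const_mul]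
  linarith

lemma exists_weakDeriv_of_higher (hΩ : IsOpen Ω) (hc : Ω.OrdConnected) (hn : Ω.Nonempty)
    (hJ : LocallyIntegrableOn J Ω) (m : ℕ) {v : ℝ → ℝ} (hv : LocallyIntegrableOn v Ω)
    (h : ∀ φ, IsTestFunction Ω φ →
      ∫ x in Ω, J x * iteratedDeriv (m + 1) φ x = ∫ x in Ω, v x * φ x) :
    ∃ w, LocallyIntegrableOn w Ω ∧ ∀ φ, IsTestFunction Ω φ →
      ∫ x in Ω, J x * iteratedDeriv 1 φ x = ∫ x in Ω, w x * φ x := by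
  induction m generalizing v with
  | zero => exact ⟨v, hv, h⟩
  | succ m ih =>
    obtain ⟨w, hw, hw'⟩ := exists_lower_deriv hΩ hc hn hJ hv (m + 1) h
    exact ih hw hw'

/-- A function with a weak derivative agrees with a primitive of it up to a constant. -/
lemma IsWeakDeriv.exists_eq_primitive (hΩ : IsOpen Ω) (hc : Ω.OrdConnected)
    (h : IsWeakDeriv Ω 1 J w) {x₀ : ℝ} (hx₀ : x₀ ∈ Ω) :
    ∃ C, ∀ᵐ x, x ∈ Ω → J x = C + ∫ t in x₀..x, w t := by
  rw [isWeakDeriv_one_iff] at h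
  obtain ⟨hJ, hw, h⟩ := h
  have hV := locallyIntegrableOn_primitive hΩ hc hw hx₀
  obtain ⟨C, hC⟩ := exists_const_of_forall_deriv_eq_zero hΩ hc ⟨x₀, hx₀⟩
    (fun ψ => (∫ x in Ω, J x * ψ x) - ∫ x in Ω, (∫ t in x₀..x, w t) * ψ x)
    (fun φ χ hφ hχ c => by
      simp only
      rw [integral_test_sub_mul hJ hφ hχ, integral_test_sub_mul hV hφ hχ]
      ring)
    (fun φ hφ => by
      rw [integral_primitive_mul_deriv hc hw hx₀ hφ, h φ hφ]
      ring)
  refine ⟨C, ae_eq_of_integral_test_eq hΩ hJ ((locallyIntegrableOn_const C).add hV)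
    fun φ hφ => ?_⟩
  have h1 := hC φ hφ
  simp only [add_mul]
  rw [integral_add (hφ.integrable.integrableOn.const_mul C) (integrableOn_mul_test hV hφ),
    setIntegral_mul_test hφ fun _ => C, integral_const_mul]
  linarith

end dubois

/-! ### Linearity -/

/-- A fractional derivative of a test function need not have compact support. Continuity and
boundedness are what make its pairing with an integrable `u` converge. -/
lemma exists_bound_classicalDeriv_right {Ω : Set ℝ} {φ : ℝ → ℝ} {α : ℝ} (hα : 0 ≤ α)
    (hφ : IsTestFunction Ω φ) :
    Continuous (classicalDeriv .right α φ) ∧ ∃ M, ∀ x, |classicalDeriv .right α φ x| ≤ M := by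
  by_cases h : (⌊α⌋₊ : ℝ) = α
  · rw [classicalDeriv_natCast _ h]
    obtain ⟨M, -, hM⟩ := (hφ.iteratedDeriv ⌊α⌋₊).exists_bound
    exact ⟨(hφ.iteratedDeriv ⌊α⌋₊).continuous, M, hM⟩
  · have hc := continuous_rightInt (floor_add_one_sub_pos α) (hφ.iteratedDeriv (⌊α⌋₊ + 1))
    obtain ⟨M, -, hM⟩ := (hφ.iteratedDeriv (⌊α⌋₊ + 1)).abs_rightInt_le (floor_add_one_sub_pos α)
      (floor_add_one_sub_lt_one hα h).le
    constructor
    · rw [funext (classicalDeriv_right h hφ)]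
      exact continuous_const.mul hc
    · refine ⟨M, fun x => ?_⟩
      rw [classicalDeriv_right h hφ, abs_mul, abs_pow, abs_neg, abs_one, one_pow, one_mul]
      exact hM x

lemma exists_bound_classicalDeriv (s : Side) {Ω : Set ℝ} {φ : ℝ → ℝ} {α : ℝ} (hα : 0 ≤ α)
    (hφ : IsTestFunction Ω φ) :
    Continuous (classicalDeriv s α φ) ∧ ∃ M, ∀ x, |classicalDeriv s α φ x| ≤ M := by
  cases s with
  | right => exact exists_bound_classicalDeriv_right hα hφ
  | left =>
    by_cases h : (⌊α⌋₊ : ℝ) = α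
    · rw [classicalDeriv_natCast _ h, ← classicalDeriv_natCast .right h]
      exact exists_bound_classicalDeriv_right hα hφ
    · obtain ⟨hc, M, hM⟩ := exists_bound_classicalDeriv_right hα hφ.comp_neg
      rw [funext (classicalDeriv_left h φ)]
      exact ⟨hc.comp continuous_neg, M, fun x => hM _⟩

lemma IsWeakFracDeriv.linear {s : Side} {Ω : Set ℝ} {α : ℝ} (hα : 0 ≤ α) (c d : ℝ)
    {u v p q : ℝ → ℝ} (hu : IsWeakFracDeriv s Ω α u p) (hv : IsWeakFracDeriv s Ω α v q) :
    IsWeakFracDeriv s Ω α (fun x => c * u x + d * v x) (fun x => c * p x + d * q x) := by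
  refine ⟨(hu.1.const_mul c).add (hv.1.const_mul d),
    (locallyIntegrableOn_const_mul hu.2.1 c).add (locallyIntegrableOn_const_mul hv.2.1 d),
    fun φ hφ => ?_⟩
  obtain ⟨hc, M, hM⟩ := exists_bound_classicalDeriv s.opp hα hφ
  have hi : ∀ f : ℝ → ℝ, IntegrableOn f Ω →
      IntegrableOn (fun x => f x * classicalDeriv s.opp α φ x) Ω := fun f hf =>
    hf.mul_bdd hc.aestronglyMeasurable (ae_of_all _ hM)
  simp only [add_mul, mul_assoc]
  rw [integral_add ((integrableOn_mul_test hu.2.1 hφ).const_mul c)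
      ((integrableOn_mul_test hv.2.1 hφ).const_mul d),
    integral_add ((hi u hu.1).const_mul c) ((hi v hv.1).const_mul d)]
  simp only [integral_const_mul]
  rw [hu.2.2 φ hφ, hv.2.2 φ hφ]
  ring

/-! ### Orders above one -/

section higher

variable {Ω : Set ℝ} {α : ℝ} {u v : ℝ → ℝ}

lemma floor_fract (α : ℝ) : ⌊Int.fract α⌋₊ = 0 :=
  Nat.floor_eq_zero.2 (Int.fract_lt_one α)

lemma fract_eq_sub (hα : 0 ≤ α) : Int.fract α = α - ⌊α⌋₊ := by
  rw [← Int.self_sub_floor, natCast_floor_eq_intCast_floor hα]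

lemma fract_eq_zero_iff (hα : 0 ≤ α) : Int.fract α = 0 ↔ (⌊α⌋₊ : ℝ) = α := by
  rw [fract_eq_sub hα, sub_eq_zero, eq_comm]

lemma integrable_indicator_of (hΩ : IsOpen Ω) (hu : IntegrableOn u Ω) :
    Integrable (Ω.indicator u) := by
  rwa [integrable_indicator_iff hΩ.measurableSet]

lemma integral_mul_rightInt_test {γ : ℝ} (hΩ : IsOpen Ω) (hγ : 0 < γ) (hγ1 : γ ≤ 1)
    (hu : IntegrableOn u Ω) {φ : ℝ → ℝ} (hφ : IsTestFunction Ω φ) :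
    ∫ x in Ω, u x * rightInt γ φ x = ∫ x in Ω, leftInt γ (Ω.indicator u) x * φ x := by
  obtain ⟨M, -, hM⟩ := hφ.exists_bound
  rw [setIntegral_mul_eq_indicator hΩ.measurableSet, setIntegral_mul_test hφ,
    integral_mul_rightInt hγ hγ1 (integrable_indicator_of hΩ hu) hφ.integrable hM]

/-- For orders below one, the weak fractional derivative is the weak derivative of the fractional
integral. -/
lemma isWeakFracDeriv_left_iff_isWeakDeriv (hΩ : IsOpen Ω) (hα : 0 < α) (hα1 : α < 1) :
    IsWeakFracDeriv .left Ω α u v ↔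
      IntegrableOn u Ω ∧ IsWeakDeriv Ω 1 (leftInt (1 - α) (Ω.indicator u)) v := by
  have hf : ⌊α⌋₊ = 0 := Nat.floor_eq_zero.2 hα1
  have hne : (⌊α⌋₊ : ℝ) ≠ α := by rw [hf]; simpa using hα.ne
  rw [isWeakFracDeriv_left_iff hne, isWeakDeriv_one_iff]
  refine and_congr_right fun hu => ?_
  have hJ := (UnifLocIntegrable.leftInt (γ := 1 - α) (by linarith) (by linarith)
    (integrable_indicator_of hΩ hu)).1.locallyIntegrableOn Ω
  refine ⟨fun h => ⟨hJ, h.1, fun φ hφ => ?_⟩, fun h => ⟨h.2.1, fun φ hφ => ?_⟩⟩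
  · rw [h.2 φ hφ, hf, ← integral_mul_rightInt_test hΩ (by linarith) (by linarith) hu hφ.deriv]
    simp
  · rw [h.2.2 φ hφ, hf, ← integral_mul_rightInt_test hΩ (by linarith) (by linarith) hu hφ.deriv]
    simp

/-- Here the fractional part is zero, and `w = u` serves as derivative of order zero; any other
choice of `w` pairs with test functions in the same way. -/
lemma isWeakFracDeriv_natCast_iff (s : Side) (h : (⌊α⌋₊ : ℝ) = α) :
    IsWeakFracDeriv s Ω α u v ↔
      ∃ w : ℝ → ℝ, IsWeakFracDeriv s Ω 0 u w ∧ IsWeakDeriv Ω ⌊α⌋₊ w v := by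
  have h0 : ∀ φ : ℝ → ℝ, classicalDeriv s.opp 0 φ = φ := fun φ => by
    rw [classicalDeriv_natCast _ (by simp)]; simp
  unfold IsWeakFracDeriv
  simp only [classicalDeriv_natCast _ h, h0, Nat.floor_zero, pow_zero, one_mul]
  constructor
  · rintro ⟨hu, hv, hd⟩
    exact ⟨u, ⟨hu, hu.locallyIntegrableOn, fun _ _ => rfl⟩, hu.locallyIntegrableOn, hv, hd⟩
  · rintro ⟨w, ⟨hu, hw, h1⟩, -, hv, h2⟩
    exact ⟨hu, hv, fun φ hφ => by rw [h2 φ hφ, h1 _ (hφ.iteratedDeriv _)]⟩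

/-- Let `m = [α]`. The datum is `∫ v φ = -∫ J φ^(m+1)`, so lowering the order yields `w = J'`. Then
`∫ w φ^(m) = -∫ J φ^(m+1) = ∫ v φ`, whereas the weak derivative of order `m` carries `(-1)^m`: hence
the sign in front of `v`. -/
lemma isWeakFracDeriv_left_iff_fract (hΩ : IsOpen Ω) (hc : Ω.OrdConnected) (hn : Ω.Nonempty)
    (hα : 0 ≤ α) (h : (⌊α⌋₊ : ℝ) ≠ α) :
    IsWeakFracDeriv .left Ω α u v ↔
      ∃ w : ℝ → ℝ, IsWeakFracDeriv .left Ω (Int.fract α) u w ∧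
        IsWeakDeriv Ω ⌊α⌋₊ w (fun x => (-1) ^ ⌊α⌋₊ * v x) := by
  have hσ0 : 0 < Int.fract α := by
    rw [fract_eq_sub hα, sub_pos]
    exact lt_of_le_of_ne (Nat.floor_le hα) h
  have hσ1 := Int.fract_lt_one α
  have hγ : (⌊α⌋₊ : ℝ) + 1 - α = 1 - Int.fract α := by rw [fract_eq_sub hα]; ring
  have hsq : ((-1 : ℝ) ^ ⌊α⌋₊) * (-1) ^ ⌊α⌋₊ = 1 := by
    rw [← pow_add, Even.neg_one_pow ⟨_, rfl⟩]
  have hiff : ∀ w, IsWeakFracDeriv .left Ω (Int.fract α) u w ↔ _ := fun w =>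
    isWeakFracDeriv_left_iff_isWeakDeriv (u := u) (v := w) hΩ hσ0 hσ1
  simp only [hiff, isWeakDeriv_one_iff]
  rw [isWeakFracDeriv_left_iff h, hγ]
  set J := leftInt (1 - Int.fract α) (Ω.indicator u) with hJdef
  have hkey : IntegrableOn u Ω → ∀ φ, IsTestFunction Ω φ →
      ∫ x in Ω, u x * rightInt (1 - Int.fract α) (iteratedDeriv (⌊α⌋₊ + 1) φ) x =
        ∫ x in Ω, J x * iteratedDeriv (⌊α⌋₊ + 1) φ x := fun hu φ hφ =>
    integral_mul_rightInt_test hΩ (by linarith) (by linarith) hu (hφ.iteratedDeriv _)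
  constructor
  · rintro ⟨hu, hv, hd⟩
    have hJ : LocallyIntegrableOn J Ω :=
      (UnifLocIntegrable.leftInt (γ := 1 - Int.fract α) (by linarith) (by linarith)
        (integrable_indicator_of hΩ hu)).1.locallyIntegrableOn Ω
    obtain ⟨w, hw, hw'⟩ := exists_weakDeriv_of_higher hΩ hc hn hJ ⌊α⌋₊
      (locallyIntegrableOn_const_mul hv (-1)) fun φ hφ => by
        simp only [mul_assoc]
        rw [integral_const_mul, hd φ hφ, hkey hu φ hφ]
        ring
    simp only [iteratedDeriv_one] at hw'
    have hw2 : ∀ φ, IsTestFunction Ω φ →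
        ∫ x in Ω, (-1 * w x) * φ x = -∫ x in Ω, J x * deriv φ x := fun φ hφ => by
      simp only [mul_assoc]
      rw [integral_const_mul, hw' φ hφ]
      ring
    refine ⟨fun x => -1 * w x, ⟨hu, hJ, locallyIntegrableOn_const_mul hw (-1), hw2⟩,
      locallyIntegrableOn_const_mul hw (-1), locallyIntegrableOn_const_mul hv _, fun φ hφ => ?_⟩
    rw [hw2 _ (hφ.iteratedDeriv _), ← iteratedDeriv_succ, ← hkey hu φ hφ, ← hd φ hφ]
    simp only [mul_assoc]
    rw [integral_const_mul]
  · rintro ⟨w, ⟨hu, hJ, hw, h1⟩, -, hv, h2⟩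
    have hv' : LocallyIntegrableOn v Ω := by
      have := locallyIntegrableOn_const_mul hv ((-1) ^ ⌊α⌋₊)
      simpa only [← mul_assoc, hsq, one_mul] using this
    refine ⟨hu, hv', fun φ hφ => ?_⟩
    have h3 := h2 φ hφ
    rw [h1 _ (hφ.iteratedDeriv _), ← iteratedDeriv_succ, ← hkey hu φ hφ] at h3
    simp only [mul_assoc] at h3
    rw [integral_const_mul] at h3
    exact mul_left_cancel₀ (pow_ne_zero _ (by norm_num)) h3

/-- Reflecting a weak derivative of order `[α]` contributes another `(-1)^[α]`, which cancels the
sign of the left case. -/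
lemma isWeakFracDeriv_right_iff_fract (hΩ : IsOpen Ω) (hc : Ω.OrdConnected) (hn : Ω.Nonempty)
    (hα : 0 ≤ α) (h : (⌊α⌋₊ : ℝ) ≠ α) :
    IsWeakFracDeriv .right Ω α u v ↔
      ∃ w : ℝ → ℝ, IsWeakFracDeriv .right Ω (Int.fract α) u w ∧ IsWeakDeriv Ω ⌊α⌋₊ w v := by
  have hσ : (⌊Int.fract α⌋₊ : ℝ) ≠ Int.fract α := by
    rw [floor_fract, Nat.cast_zero]
    exact fun h' => h ((fract_eq_zero_iff hα).1 h'.symm)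
  have hc' : (-Ω).OrdConnected := by
    refine ⟨fun x hx y hy z hz => ?_⟩
    exact hc.out hy hx ⟨neg_le_neg hz.2, neg_le_neg hz.1⟩
  rw [isWeakFracDeriv_right_iff hΩ h, isWeakFracDeriv_left_iff_fract hΩ.neg hc' hn.neg hα h]
  constructor
  · rintro ⟨w, h1, h2⟩
    refine ⟨fun x => w (-x), ?_, ?_⟩
    · rw [isWeakFracDeriv_right_iff hΩ hσ]
      simpa using h1
    · have := h2.comp_neg hΩ.neg
      simp only [neg_neg, ← mul_assoc, ← pow_add] at this
      rw [Even.neg_one_pow ⟨_, rfl⟩] at this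
      simpa using this
  · rintro ⟨w, h1, h2⟩
    exact ⟨fun x => w (-x), (isWeakFracDeriv_right_iff hΩ hσ).1 h1, h2.comp_neg hΩ⟩

end higher

/-! ### Marchaud derivatives -/

/-- The left Marchaud derivative of order `1 - γ`. -/
noncomputable def marchaud (γ : ℝ) (f : ℝ → ℝ) (x : ℝ) : ℝ :=
  (1 - γ) / Real.Gamma γ * ∫ t in Ioi 0, (f x - f (x - t)) * t ^ (γ - 2)

/-! ### Absolute convergence against the weight `t^(γ - 2)`. -/

section weights

variable {γ δ D : ℝ}

/-- At infinity the weight is integrable since `γ < 1`. At zero the linear bound on `g` leaves `t^(γ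
- 1)`, integrable since `γ > 0`. -/
lemma integrableOn_mul_rpow {g : ℝ → ℝ} (hγ : 0 < γ) (hγ1 : γ < 1) (hδ : 0 < δ)
    (hg : AEStronglyMeasurable g (volume.restrict (Ioi 0))) (h1 : ∀ t, 0 < t → |g t| ≤ D)
    (h2 : ∀ t, 0 < t → t ≤ δ → |g t| ≤ D * t) :
    IntegrableOn (fun t => g t * t ^ (γ - 2)) (Ioi 0) := by
  have hm : AEStronglyMeasurable (fun t => g t * t ^ (γ - 2)) (volume.restrict (Ioi 0)) :=
    hg.mul (Measurable.aestronglyMeasurable (by fun_prop))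
  rw [← Ioc_union_Ioi_eq_Ioi hδ.le] at hm ⊢
  refine IntegrableOn.union ?_ ?_
  · have hi : IntegrableOn (fun t : ℝ => D * t ^ (γ - 1)) (Ioc 0 δ) :=
      ((intervalIntegrable_iff_integrableOn_Ioc_of_le hδ.le).1
        (intervalIntegral.intervalIntegrable_rpow' (by linarith))).const_mul _
    refine Integrable.mono' hi (hm.mono_measure (Measure.restrict_mono subset_union_left le_rfl)) ?_
    filter_upwards [ae_restrict_mem measurableSet_Ioc] with t ht
    rw [norm_mul, Real.norm_eq_abs, Real.norm_of_nonneg (Real.rpow_nonneg ht.1.le _),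
      show γ - 1 = (γ - 2) + 1 by ring, Real.rpow_add_one ht.1.ne', mul_comm _ t, ← mul_assoc]
    exact mul_le_mul_of_nonneg_right (h2 t ht.1 ht.2) (Real.rpow_nonneg ht.1.le _)
  · have hi : IntegrableOn (fun t : ℝ => D * t ^ (γ - 2)) (Ioi δ) :=
      (integrableOn_Ioi_rpow_of_lt (by linarith) hδ).const_mul _
    refine Integrable.mono' hi
      (hm.mono_measure (Measure.restrict_mono subset_union_right le_rfl)) ?_
    filter_upwards [ae_restrict_mem measurableSet_Ioi] with t ht
    have ht0 : 0 < t := hδ.trans ht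
    rw [norm_mul, Real.norm_eq_abs, Real.norm_of_nonneg (Real.rpow_nonneg ht0.le _)]
    exact mul_le_mul_of_nonneg_right (h1 t ht0) (Real.rpow_nonneg ht0.le _)

/-- Integrating in `x` first reduces this to the one-variable criterion for the `L¹` norms of the
slices `G (·, t)`. -/
lemma integrable_prod_mul_rpow {G : ℝ × ℝ → ℝ} (hγ : 0 < γ) (hγ1 : γ < 1) (hδ : 0 < δ)
    (hG : AEStronglyMeasurable G (volume.prod volume))
    (h0 : ∀ t, 0 < t → Integrable fun x => G (x, t))
    (h1 : ∀ t, 0 < t → ∫ x, |G (x, t)| ≤ D)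
    (h2 : ∀ t, 0 < t → t ≤ δ → ∫ x, |G (x, t)| ≤ D * t) :
    Integrable (fun p : ℝ × ℝ => G p * p.2 ^ (γ - 2))
      ((volume : Measure ℝ).prod (volume.restrict (Ioi 0))) := by
  have hG' : AEStronglyMeasurable G ((volume : Measure ℝ).prod (volume.restrict (Ioi 0))) :=
    hG.mono_ac (Measure.AbsolutelyContinuous.rfl.prod
      (Measure.absolutelyContinuous_of_le Measure.restrict_le_self))
  have hm : AEStronglyMeasurable (fun p : ℝ × ℝ => G p * p.2 ^ (γ - 2))
      ((volume : Measure ℝ).prod (volume.restrict (Ioi 0))) :=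
    hG'.mul (Measurable.aestronglyMeasurable (by fun_prop))
  rw [integrable_prod_iff' hm]
  constructor
  · filter_upwards [ae_restrict_mem measurableSet_Ioi] with t ht
    exact (h0 t ht).mul_const (t ^ (γ - 2))
  · have hI := integrableOn_mul_rpow (g := fun t => ∫ x, |G (x, t)|) hγ hγ1 hδ
      (by simpa using hG'.norm.prod_swap.integral_prod_right')
      (fun t ht => by
        rw [abs_of_nonneg (integral_nonneg fun _ => abs_nonneg _)]; exact h1 t ht)
      (fun t ht ht' => by
        rw [abs_of_nonneg (integral_nonneg fun _ => abs_nonneg _)]; exact h2 t ht ht')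
    refine Integrable.congr hI ?_
    filter_upwards [ae_restrict_mem measurableSet_Ioi] with t ht
    simp only [norm_mul, Real.norm_eq_abs]
    rw [integral_mul_const, abs_of_nonneg (Real.rpow_nonneg (le_of_lt ht) _)]

end weights

/-! ### Marchaud form for test functions. -/

section test

variable {Ω : Set ℝ} {φ : ℝ → ℝ} {γ : ℝ}

lemma IsTestFunction.abs_sub_le (h : IsTestFunction Ω φ) {L : ℝ}
    (hL : ∀ x, |_root_.deriv φ x| ≤ L) {t : ℝ} (ht : 0 ≤ t) (x : ℝ) :
    |φ x - φ (x + t)| ≤ L * t := by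
  have := convex_univ.norm_image_sub_le_of_norm_deriv_le (f := φ)
    (fun y _ => (h.hasDerivAt y).differentiableAt) (fun y _ => hL y) (mem_univ (x + t))
    (mem_univ x)
  rw [Real.norm_eq_abs, Real.norm_eq_abs, sub_add_cancel_left, abs_neg, abs_of_nonneg ht] at this
  exact this

/-- The right fractional integral of a derivative, in Marchaud form. -/
lemma IsTestFunction.rightInt_deriv_eq (h : IsTestFunction Ω φ) (hγ : 0 < γ) (hγ1 : γ < 1)
    (x : ℝ) : rightInt γ (_root_.deriv φ) x =
      -((1 - γ) / Real.Gamma γ * ∫ t in Ioi 0, (φ x - φ (x + t)) * t ^ (γ - 2)) := by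
  obtain ⟨M, hM0, hM⟩ := h.exists_bound
  obtain ⟨L, hL0, hL⟩ := h.deriv.exists_bound
  have hlip := fun t ht => h.abs_sub_le hL (t := t) ht x
  have hbd : ∀ t, |φ x - φ (x + t)| ≤ 2 * M := fun t =>
    (abs_sub _ _).trans (by linarith [hM x, hM (x + t)])
  have hcont : Continuous fun t => φ x - φ (x + t) :=
    continuous_const.sub (h.continuous.comp (continuous_const.add continuous_id))
  have hI := integrableOn_mul_rpow (D := 2 * M + L) (g := fun t => φ x - φ (x + t)) hγ hγ1 one_pos
    hcont.aestronglyMeasurable (fun t _ => (hbd t).trans (by linarith))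
    (fun t ht _ => (hlip t ht.le).trans (by nlinarith))
  have hK : IntegrableOn (fun t => t ^ (γ - 1) * _root_.deriv φ (x + t)) (Ioi 0) := by
    refine IntegrableOn.congr_fun (((h.deriv.integrable_rlKernel_mul hγ x).const_mul
      (Real.Gamma γ)).integrableOn) (fun t ht => ?_) measurableSet_Ioi
    have := (Real.Gamma_pos_of_pos hγ).ne'
    rw [rlKernel_of_pos ht]
    field_simp
  -- The antiderivative `φ (x + t) - φ x` is chosen to vanish at `t = 0`, so that the boundary term
  -- there is `O(t^γ)`.
  have hparts := integral_Ioi_mul_deriv_eq_deriv_mul (a := 0) (a' := 0) (b' := 0)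
    (u := fun t => t ^ (γ - 1)) (u' := fun t => (γ - 1) * t ^ (γ - 2))
    (v := fun t => φ (x + t) - φ x) (v' := fun t => _root_.deriv φ (x + t))
    (fun t ht => by
      have := Real.hasDerivAt_rpow_const (x := t) (p := γ - 1) (Or.inl (ne_of_gt ht))
      rwa [show γ - 1 - 1 = γ - 2 by ring] at this)
    (fun t _ => ((h.hasDerivAt (x + t)).comp_const_add x t).sub_const _)
    hK
    (by
      refine Integrable.congr (hI.const_mul (1 - γ)) (ae_of_all _ fun t => ?_)
      simp only [Pi.mul_apply]
      ring)
    (by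
      have hlim : Tendsto (fun t : ℝ => L * t ^ γ) (𝓝[>] 0) (𝓝 0) := by
        have := ((Real.continuous_rpow_const hγ.le).tendsto (0 : ℝ)).const_mul L
        rw [Real.zero_rpow hγ.ne', mul_zero] at this
        exact this.mono_left nhdsWithin_le_nhds
      refine squeeze_zero_norm' ?_ hlim
      filter_upwards [self_mem_nhdsWithin] with t ht
      have ht0 : 0 < t := ht
      rw [Pi.mul_apply, norm_mul, Real.norm_of_nonneg (Real.rpow_nonneg ht0.le _),
        Real.norm_eq_abs, abs_sub_comm]
      calc t ^ (γ - 1) * |φ x - φ (x + t)| ≤ t ^ (γ - 1) * (L * t) :=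
            mul_le_mul_of_nonneg_left (hlip t ht0.le) (Real.rpow_nonneg ht0.le _)
        _ = L * t ^ γ := by
          rw [show γ = γ - 1 + 1 by ring, Real.rpow_add_one ht0.ne']; ring_nf)
    (by
      have hlim : Tendsto (fun t : ℝ => t ^ (γ - 1) * (2 * M)) atTop (𝓝 0) := by
        have := (tendsto_rpow_neg_atTop (y := 1 - γ) (by linarith)).mul_const (2 * M)
        rwa [zero_mul, neg_sub] at this
      refine squeeze_zero_norm' ?_ hlim
      filter_upwards [eventually_gt_atTop 0] with t ht0
      rw [Pi.mul_apply, norm_mul, Real.norm_of_nonneg (Real.rpow_nonneg ht0.le _),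
        Real.norm_eq_abs, abs_sub_comm]
      exact mul_le_mul_of_nonneg_left (hbd t) (Real.rpow_nonneg ht0.le _))
  have h1 : rightInt γ (_root_.deriv φ) x =
      (Real.Gamma γ)⁻¹ * ∫ t in Ioi 0, t ^ (γ - 1) * _root_.deriv φ (x + t) := by
    rw [← integral_const_mul, ← integral_indicator measurableSet_Ioi]
    unfold rightInt
    congr 1; ext t
    by_cases ht : 0 < t
    · rw [rlKernel_of_pos ht, indicator_of_mem (show t ∈ Ioi (0 : ℝ) from ht)]
      ring
    · rw [rlKernel_of_nonpos (not_lt.1 ht), indicator_of_notMem (by simpa using ht), zero_mul]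
  rw [h1, hparts]
  have h2 : ∫ t in Ioi 0, (γ - 1) * t ^ (γ - 2) * (φ (x + t) - φ x) =
      (1 - γ) * ∫ t in Ioi 0, (φ x - φ (x + t)) * t ^ (γ - 2) := by
    rw [← integral_const_mul]
    congr 1; ext t; ring
  rw [h2]
  ring

end test

/-! ### Joint integrability of increments, first those of a test function, then those of `f`. -/

section local_bounds

variable {Ω : Set ℝ} {φ f : ℝ → ℝ} {γ : ℝ}

lemma UnifLocIntegrable.nonneg_bound (hf : UnifLocIntegrable f) (R : ℝ) :
    ∃ C, 0 ≤ C ∧ ∀ z, ∫ x in Icc (z - R) (z + R), |f x| ≤ C := by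
  obtain ⟨C, hC⟩ := hf.2 R
  exact ⟨C, (integral_nonneg fun _ => abs_nonneg _).trans (hC 0), hC⟩

lemma UnifLocIntegrable.integrable_indicator (hf : UnifLocIntegrable f) (a b : ℝ) :
    Integrable ((Icc a b).indicator fun x => |f x|) := by
  rw [integrable_indicator_iff measurableSet_Icc]
  exact (hf.1.integrableOn_isCompact isCompact_Icc).abs

lemma aestronglyMeasurable_sub_prod (hf : AEStronglyMeasurable f) :
    AEStronglyMeasurable (fun p : ℝ × ℝ => f (p.1 - p.2)) (volume.prod volume) :=
  hf.comp_quasiMeasurePreserving (quasiMeasurePreserving_sub_of_right_invariant volume volume)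

/-- For large `t` the two translates of `φ` live on windows around `0` and `-t`, each carrying
bounded mass of `f`. For `t ≤ 1` the Lipschitz bound on `φ` gives a factor `t` on the single window
of radius `R + 1`. -/
lemma integrable_prod_test (hf : UnifLocIntegrable f) (hφ : IsTestFunction Ω φ) (hγ : 0 < γ)
    (hγ1 : γ < 1) :
    Integrable (fun p : ℝ × ℝ => f p.1 * (φ p.1 - φ (p.1 + p.2)) * p.2 ^ (γ - 2))
      ((volume : Measure ℝ).prod (volume.restrict (Ioi 0))) := by
  obtain ⟨M, hM0, hM⟩ := hφ.exists_bound
  obtain ⟨L, hL0, hL⟩ := hφ.deriv.exists_bound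
  obtain ⟨R, hR0, hR⟩ := hφ.exists_abs_bound
  obtain ⟨C, hC0, hC⟩ := hf.nonneg_bound R
  obtain ⟨C', hC0', hC'⟩ := hf.nonneg_bound (R + 1)
  have hfm : AEStronglyMeasurable f := hf.1.aestronglyMeasurable
  have hzero : ∀ x, x ∉ Icc (0 - R) (0 + R) → φ x = 0 := fun x hx => hR x (by
    by_contra h
    rw [not_lt, abs_le] at h
    exact hx ⟨by linarith [h.1], by linarith [h.2]⟩)
  have hb1 : ∀ t x, |f x * (φ x - φ (x + t))| ≤ M * (Icc (0 - R) (0 + R)).indicator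
      (fun x => |f x|) x + M * (Icc (-t - R) (-t + R)).indicator (fun x => |f x|) x := by
    intro t x
    have e1 : |f x * φ x| ≤ M * (Icc (0 - R) (0 + R)).indicator (fun x => |f x|) x := by
      by_cases hx : x ∈ Icc (0 - R) (0 + R)
      · rw [indicator_of_mem hx, abs_mul, mul_comm]
        exact mul_le_mul_of_nonneg_right (hM x) (abs_nonneg _)
      · rw [hzero x hx, indicator_of_notMem hx]
        simp
    have e2 : |f x * φ (x + t)| ≤ M * (Icc (-t - R) (-t + R)).indicator (fun x => |f x|) x := by
      by_cases hx : x ∈ Icc (-t - R) (-t + R)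
      · rw [indicator_of_mem hx, abs_mul, mul_comm]
        exact mul_le_mul_of_nonneg_right (hM _) (abs_nonneg _)
      · rw [hzero (x + t) fun h' => hx ⟨by linarith [h'.1], by linarith [h'.2]⟩,
          indicator_of_notMem hx]
        simp
    rw [mul_sub]
    exact (abs_sub _ _).trans (add_le_add e1 e2)
  have hb1i : ∀ t, Integrable fun x => M * (Icc (0 - R) (0 + R)).indicator
      (fun x => |f x|) x + M * (Icc (-t - R) (-t + R)).indicator (fun x => |f x|) x := fun t =>
    ((hf.integrable_indicator _ _).const_mul M).add ((hf.integrable_indicator _ _).const_mul M)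
  have hmt : ∀ t, AEStronglyMeasurable fun x => f x * (φ x - φ (x + t)) := fun t =>
    hfm.mul (hφ.continuous.sub
      (hφ.continuous.comp (continuous_id.add continuous_const))).aestronglyMeasurable
  have hi : ∀ t, Integrable fun x => f x * (φ x - φ (x + t)) := fun t =>
    (hb1i t).mono' (hmt t) (ae_of_all _ (hb1 t))
  refine integrable_prod_mul_rpow (D := (M * C + M * C) + L * C') hγ hγ1 one_pos ?_
    (fun t _ => hi t) (fun t _ => ?_) (fun t ht ht1 => ?_)
  · refine hfm.comp_fst.mul (Continuous.aestronglyMeasurable ?_)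
    exact (hφ.continuous.comp continuous_fst).sub
      (hφ.continuous.comp (continuous_fst.add continuous_snd))
  · refine (integral_mono (hi t).abs (hb1i t) (hb1 t)).trans ?_
    rw [integral_add ((hf.integrable_indicator _ _).const_mul M)
      ((hf.integrable_indicator _ _).const_mul M), integral_const_mul, integral_const_mul,
      integral_indicator measurableSet_Icc, integral_indicator measurableSet_Icc]
    have := mul_le_mul_of_nonneg_left (hC 0) hM0
    have := mul_le_mul_of_nonneg_left (hC (-t)) hM0
    nlinarith
  · have hb2 : ∀ x, |f x * (φ x - φ (x + t))| ≤
        L * t * (Icc (0 - (R + 1)) (0 + (R + 1))).indicator (fun x => |f x|) x := by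
      intro x
      by_cases hx : x ∈ Icc (0 - (R + 1)) (0 + (R + 1))
      · rw [indicator_of_mem hx, abs_mul, mul_comm]
        exact mul_le_mul_of_nonneg_right (hφ.abs_sub_le hL ht.le x) (abs_nonneg _)
      · rw [hzero x fun h' => hx ⟨by linarith [h'.1], by linarith [h'.2]⟩,
          hzero (x + t) fun h' => hx ⟨by linarith [h'.1], by linarith [h'.2]⟩,
          indicator_of_notMem hx]
        simp
    refine (integral_mono (hi t).abs ((hf.integrable_indicator _ _).const_mul _) hb2).trans ?_
    rw [integral_const_mul, integral_indicator measurableSet_Icc]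
    have h1 := mul_le_mul_of_nonneg_left (hC' 0) (mul_nonneg hL0 ht.le)
    have h2 : 0 ≤ (M * C + M * C) * t := by positivity
    nlinarith

/-- The case `f = 1`: in Marchaud form the cancellation in the increments of `φ` makes the tail
integrable. -/
lemma IsTestFunction.integrable_rightInt_deriv (h : IsTestFunction Ω φ) (hγ : 0 < γ)
    (hγ1 : γ < 1) : Integrable (rightInt γ (_root_.deriv φ)) := by
  have := ((integrable_prod_test (unifLocIntegrable_const 1) h hγ hγ1).integral_prod_left.const_mul
    ((1 - γ) / Real.Gamma γ)).neg
  refine this.congr (ae_of_all _ fun x => ?_)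
  rw [h.rightInt_deriv_eq hγ hγ1]
  simp

/-- Since `∫_{x-t}^x |w| = ∫_0^t |w (x - s)| ds`, exchanging the integrals gives at most `t` times
the total mass. The margin `δ` left of `c` leaves room for the translates. -/
lemma integral_abs_primitive_sub_le {w : ℝ → ℝ} {c d δ t : ℝ}
    (hw : IntegrableOn w (Icc (c - δ) d)) (ht : 0 ≤ t) (htδ : t ≤ δ) :
    ∫ x in Icc c d, |∫ s in (x - t)..x, w s| ≤ (∫ x in Icc (c - δ) d, |w x|) * t := by
  set W := (Icc (c - δ) d).indicator fun x => |w x| with hW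
  have hWi : Integrable W := by
    rw [hW, integrable_indicator_iff measurableSet_Icc]; exact hw.abs
  have hW0 : ∀ x, 0 ≤ W x := indicator_nonneg fun _ _ => abs_nonneg _
  have hprod0 : Integrable (fun p : ℝ × ℝ => W p.1)
      ((volume : Measure ℝ).prod (volume.restrict (Ioc 0 t))) := hWi.comp_fst _
  have hprod : Integrable (fun p : ℝ × ℝ => W (p.1 - p.2))
      ((volume : Measure ℝ).prod (volume.restrict (Ioc 0 t))) :=
    (measurePreserving_sub_prod (volume : Measure ℝ)
      (volume.restrict (Ioc 0 t))).integrable_comp_of_integrable hprod0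
  have hsw : ∫ x, ∫ s in Ioc 0 t, W (x - s) = (∫ x, W x) * t := by
    rw [integral_integral_swap hprod]
    simp only [integral_sub_right_eq_self W]
    rw [setIntegral_const, smul_eq_mul, Measure.real, Real.volume_Ioc, sub_zero,
      ENNReal.toReal_ofReal ht, mul_comm]
  rw [← integral_indicator measurableSet_Icc, ← integral_indicator measurableSet_Icc, ← hW, ← hsw]
  refine integral_mono_of_nonneg (ae_of_all _ (indicator_nonneg fun _ _ => abs_nonneg _))
    hprod.integral_prod_left (ae_of_all _ fun x => ?_)
  have h0 : 0 ≤ ∫ s in Ioc 0 t, W (x - s) := integral_nonneg fun _ => hW0 _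
  by_cases hx : x ∈ Icc c d
  · rw [indicator_of_mem hx, intervalIntegral.integral_of_le (by linarith)]
    refine (abs_integral_le_integral_abs).trans (le_of_eq ?_)
    have h1 : ∫ s in Ioc (x - t) x, |w s| = ∫ s in Ioc (x - t) x, W s := by
      refine setIntegral_congr_fun measurableSet_Ioc fun s hs => ?_
      rw [hW, indicator_of_mem]
      exact ⟨by linarith [hs.1, hx.1], hs.2.trans hx.2⟩
    rw [h1, ← intervalIntegral.integral_of_le (by linarith)]
    simp only
    rw [← intervalIntegral.integral_of_le ht, intervalIntegral.integral_comp_sub_left, sub_zero]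
  · rw [indicator_of_notMem hx]
    exact h0

/-- The increments now fall on `f`, which is not Lipschitz; the factor `t` for small `t` comes from
the `L¹` modulus of continuity of a primitive. Large `t` needs only uniform bounds on windows of
length `d - c`. -/
lemma integrable_prod_primitive {w χ : ℝ → ℝ} {M c d δ : ℝ} (hf : UnifLocIntegrable f)
    (hχ : AEStronglyMeasurable χ) (hM : ∀ x, |χ x| ≤ M) (hz : ∀ x, x ∉ Icc c d → χ x = 0)
    (hδ : 0 < δ) (hw : IntegrableOn w (Icc (c - δ) d))
    (hfw : ∀ t, 0 < t → t ≤ δ → ∀ᵐ x, x ∈ Icc c d → f x - f (x - t) = ∫ s in (x - t)..x, w s)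
    (hγ : 0 < γ) (hγ1 : γ < 1) :
    Integrable (fun p : ℝ × ℝ => χ p.1 * (f p.1 - f (p.1 - p.2)) * p.2 ^ (γ - 2))
      ((volume : Measure ℝ).prod (volume.restrict (Ioi 0))) := by
  have hM0 : 0 ≤ M := (abs_nonneg _).trans (hM 0)
  obtain ⟨C, hC0, hC⟩ := hf.nonneg_bound ((d - c) / 2)
  have hfm : AEStronglyMeasurable f := hf.1.aestronglyMeasurable
  have hft : ∀ t, AEStronglyMeasurable fun x => f (x - t) := fun t =>
    hfm.comp_quasiMeasurePreserving (measurePreserving_sub_right volume t).quasiMeasurePreserving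
  set A := fun t x => M * (Icc c d).indicator (fun x => |f x|) x +
    M * (Icc (c - t) (d - t)).indicator (fun x => |f x|) (x - t) with hA
  have hb : ∀ t x, |χ x * (f x - f (x - t))| ≤ A t x := by
    intro t x
    by_cases hx : x ∈ Icc c d
    · have hx' : x - t ∈ Icc (c - t) (d - t) := ⟨by linarith [hx.1], by linarith [hx.2]⟩
      simp only [hA]
      rw [indicator_of_mem hx, indicator_of_mem hx', abs_mul, ← mul_add]
      exact mul_le_mul (hM x) (abs_sub _ _) (abs_nonneg _) hM0
    · rw [hz x hx, zero_mul, abs_zero]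
      exact add_nonneg (mul_nonneg hM0 (indicator_nonneg (fun _ _ => abs_nonneg _) _))
        (mul_nonneg hM0 (indicator_nonneg (fun _ _ => abs_nonneg _) _))
  have hAi1 : Integrable fun x => M * (Icc c d).indicator (fun x => |f x|) x :=
    (hf.integrable_indicator _ _).const_mul M
  have hAi2 : ∀ t, Integrable fun x =>
      M * (Icc (c - t) (d - t)).indicator (fun x => |f x|) (x - t) := fun t =>
    ((hf.integrable_indicator _ _).comp_sub_right t).const_mul M
  have hi : ∀ t, Integrable fun x => χ x * (f x - f (x - t)) := fun t =>
    (hAi1.add (hAi2 t)).mono' (hχ.mul (hfm.sub (hft t))) (ae_of_all _ (hb t))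
  have hW0 : 0 ≤ ∫ x in Icc (c - δ) d, |w x| := integral_nonneg fun _ => abs_nonneg _
  refine integrable_prod_mul_rpow (G := fun p : ℝ × ℝ => χ p.1 * (f p.1 - f (p.1 - p.2)))
    (D := (M * C + M * C) + M * ∫ x in Icc (c - δ) d, |w x|) hγ hγ1 hδ
    ?_ (fun t _ => hi t) (fun t _ => ?_) (fun t ht htδ => ?_)
  · exact hχ.comp_fst.mul (hfm.comp_fst.sub (aestronglyMeasurable_sub_prod hfm))
  · refine (integral_mono (hi t).abs (hAi1.add (hAi2 t)) (hb t)).trans ?_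
    simp only [Pi.add_apply]
    rw [integral_add hAi1 (hAi2 t), integral_const_mul, integral_const_mul,
      integral_sub_right_eq_self ((Icc (c - t) (d - t)).indicator fun x => |f x|),
      integral_indicator measurableSet_Icc, integral_indicator measurableSet_Icc]
    have h1 := mul_le_mul_of_nonneg_left (hC ((c + d) / 2)) hM0
    have h2 := mul_le_mul_of_nonneg_left (hC ((c + d) / 2 - t)) hM0
    rw [show (c + d) / 2 - (d - c) / 2 = c by ring, show (c + d) / 2 + (d - c) / 2 = d by ring]
      at h1
    rw [show (c + d) / 2 - t - (d - c) / 2 = c - t by ring,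
      show (c + d) / 2 - t + (d - c) / 2 = d - t by ring] at h2
    have h3 := mul_nonneg hM0 hW0
    linarith
  · have h1 : ∀ᵐ x, |χ x * (f x - f (x - t))| ≤
        M * (Icc c d).indicator (fun x => |f x - f (x - t)|) x := by
      refine ae_of_all _ fun x => ?_
      by_cases hx : x ∈ Icc c d
      · rw [indicator_of_mem hx, abs_mul]
        exact mul_le_mul_of_nonneg_right (hM x) (abs_nonneg _)
      · simp [hz x hx, indicator_of_notMem hx]
    have h2 : IntegrableOn (fun x => |f x - f (x - t)|) (Icc c d) := by
      refine (IntegrableOn.sub (hf.1.integrableOn_isCompact isCompact_Icc) ?_).abs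
      have := (hf.integrable_indicator (c - t) (d - t)).comp_sub_right t
      refine (this.integrableOn (s := Icc c d)).mono' (hft t).restrict ?_
      filter_upwards [ae_restrict_mem measurableSet_Icc] with x hx
      rw [indicator_of_mem (show x - t ∈ Icc (c - t) (d - t) from
        ⟨by linarith [hx.1], by linarith [hx.2]⟩)]
      exact le_rfl
    refine (integral_mono_ae (hi t).abs (((integrable_indicator_iff measurableSet_Icc).2
      h2).const_mul M) h1).trans ?_
    rw [integral_const_mul, integral_indicator measurableSet_Icc]
    have h3 : ∫ x in Icc c d, |f x - f (x - t)| = ∫ x in Icc c d, |∫ s in (x - t)..x, w s| := by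
      refine setIntegral_congr_ae measurableSet_Icc ?_
      filter_upwards [hfw t ht htδ] with x hx hxm
      rw [hx hxm]
    rw [h3]
    have h4 := mul_le_mul_of_nonneg_left (integral_abs_primitive_sub_le hw ht.le htδ) hM0
    have h5 : 0 ≤ (M * C + M * C) * t := by positivity
    nlinarith

end local_bounds

/-! ### The Marchaud derivative as a weak derivative. -/

section main

variable {Ω : Set ℝ} {f w : ℝ → ℝ} {γ : ℝ}

/-- If `f` has a weak derivative, its Marchaud derivative is a weak derivative of its
fractional integral. -/
lemma marchaud_of_isWeakDeriv (hΩ : IsOpen Ω) (hc : Ω.OrdConnected) (hn : Ω.Nonempty)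
    (hf : UnifLocIntegrable f) (hfw : IsWeakDeriv Ω 1 f w) (hγ : 0 < γ) (hγ1 : γ < 1) :
    LocallyIntegrableOn (marchaud γ f) Ω ∧ ∀ φ, IsTestFunction Ω φ →
      ∫ x in Ω, marchaud γ f x * φ x = -∫ x, f x * rightInt γ (deriv φ) x := by
  obtain ⟨x₀, hx₀⟩ := hn
  obtain ⟨C, hC⟩ := hfw.exists_eq_primitive hΩ hc hx₀
  -- The cutoff `χ` is left general: an indicator gives local integrability of the Marchaud
  -- derivative, a test function gives Fubini in the duality.
  have key : ∀ c d : ℝ, c ≤ d → Icc c d ⊆ Ω → ∀ (χ : ℝ → ℝ) (M : ℝ), AEStronglyMeasurable χ →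
      (∀ x, |χ x| ≤ M) → (∀ x, x ∉ Icc c d → χ x = 0) →
      Integrable (fun p : ℝ × ℝ => χ p.1 * (f p.1 - f (p.1 - p.2)) * p.2 ^ (γ - 2))
        ((volume : Measure ℝ).prod (volume.restrict (Ioi 0))) := by
    intro c d hcd hcdΩ χ M hχ hM hz
    have hcΩ : c ∈ Ω := hcdΩ ⟨le_rfl, hcd⟩
    have hdΩ : d ∈ Ω := hcdΩ ⟨hcd, le_rfl⟩
    obtain ⟨δ, hδ, hb⟩ := Metric.nhds_basis_closedBall.mem_iff.1 (hΩ.mem_nhds hcΩ)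
    have hcδ : c - δ ∈ Ω := hb (by
      rw [Real.closedBall_eq_Icc]; exact ⟨le_rfl, by linarith⟩)
    have hsub : Icc (c - δ) d ⊆ Ω := hc.out hcδ hdΩ
    refine integrable_prod_primitive hf hχ hM hz hδ
      (hfw.2.1.integrableOn_compact_subset hsub isCompact_Icc) (fun t ht htδ => ?_) hγ hγ1
    have hC' : ∀ᵐ x, x - t ∈ Ω → f (x - t) = C + ∫ s in x₀..(x - t), w s :=
      (measurePreserving_sub_right volume t).quasiMeasurePreserving.ae hC
    filter_upwards [hC, hC'] with x h1 h2 hx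
    have hxΩ : x ∈ Ω := hcdΩ hx
    have hxt : x - t ∈ Ω := hsub ⟨by linarith [hx.1], by linarith [hx.2]⟩
    rw [h1 hxΩ, h2 hxt, add_sub_add_left_eq_sub, intervalIntegral.integral_interval_sub_left
      (intervalIntegrable_of_mem hc hfw.2.1 hx₀ hxΩ) (intervalIntegrable_of_mem hc hfw.2.1 hx₀ hxt)]
  have hfm : AEStronglyMeasurable f := hf.1.aestronglyMeasurable
  constructor
  · intro x hx
    obtain ⟨r, hr, hb⟩ := Metric.nhds_basis_closedBall.mem_iff.1 (hΩ.mem_nhds hx)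
    rw [Real.closedBall_eq_Icc] at hb
    refine ⟨Icc (x - r) (x + r), mem_nhdsWithin_of_mem_nhds
      (Icc_mem_nhds (by linarith) (by linarith)), ?_⟩
    have h1 := (key _ _ (by linarith) hb ((Icc (x - r) (x + r)).indicator fun _ => 1) 1
      ((measurable_const.indicator measurableSet_Icc).aestronglyMeasurable)
      (fun y => by by_cases h : y ∈ Icc (x - r) (x + r) <;> simp [h])
      (fun y hy => indicator_of_notMem hy _)).integral_prod_left.const_mul
      ((1 - γ) / Real.Gamma γ)
    refine (h1.integrableOn (s := Icc (x - r) (x + r))).congr_fun (fun y hy => ?_)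
      measurableSet_Icc
    simp only [indicator_of_mem hy, one_mul]
    rfl
  · intro φ hφ
    obtain ⟨c, d, hcd, hcdΩ, hs⟩ := hφ.exists_Icc hc ⟨x₀, hx₀⟩
    obtain ⟨M, -, hM⟩ := hφ.exists_bound
    have hI1 := key c d hcd hcdΩ φ M hφ.continuous.aestronglyMeasurable hM fun x hx =>
      image_eq_zero_of_notMem_tsupport fun h => hx (hs h)
    have hI2 := integrable_prod_test hf hφ hγ hγ1
    have e1 : ∫ x in Ω, marchaud γ f x * φ x = (1 - γ) / Real.Gamma γ *
        ∫ t in Ioi 0, ∫ x, φ x * (f x - f (x - t)) * t ^ (γ - 2) := by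
      rw [setIntegral_mul_test hφ, ← integral_integral_swap hI1, ← integral_const_mul]
      congr 1; ext x
      unfold marchaud
      simp only [mul_assoc (φ x)]
      rw [integral_const_mul]
      ring
    have e2 : ∫ x, f x * rightInt γ (deriv φ) x = -((1 - γ) / Real.Gamma γ *
        ∫ t in Ioi 0, ∫ x, f x * (φ x - φ (x + t)) * t ^ (γ - 2)) := by
      rw [← integral_integral_swap hI2, ← integral_const_mul, ← integral_neg]
      congr 1; ext x
      rw [hφ.rightInt_deriv_eq hγ hγ1]
      simp only [mul_assoc (f x)]
      rw [integral_const_mul]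
      ring
    rw [e1, e2, neg_neg]
    congr 2; ext t
    rw [integral_mul_const, integral_mul_const]
    congr 1
    have hfφ : Integrable fun x => f x * φ x := by
      have := hf.1.integrable_smul_right_of_hasCompactSupport hφ.continuous hφ.2.1
      simpa only [smul_eq_mul] using this
    have hfφt : Integrable fun x => f x * φ (x + t) := by
      exact hf.1.integrable_smul_right_of_hasCompactSupport
        (hφ.continuous.comp (continuous_id.add continuous_const))
        (hφ.2.1.comp_homeomorph (Homeomorph.addRight t))
    have hfφt' : Integrable fun x => f (x - t) * φ x := by
      have := hfφt.comp_sub_right t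
      simpa only [sub_add_cancel] using this
    -- At fixed `t`, a translation moves the increment from `φ` onto `f`.
    have e3 : ∫ x, f x * φ (x + t) = ∫ x, f (x - t) * φ x := by
      rw [← integral_sub_right_eq_self (fun x => f x * φ (x + t)) t]
      simp only [sub_add_cancel]
    simp only [mul_sub, mul_comm (φ _), sub_mul]
    rw [integral_sub hfφ hfφt', integral_sub hfφ hfφt, e3]

end main

/-! ### Inclusivity -/

section inclusivity

variable {Ω : Set ℝ} {u v w : ℝ → ℝ} {α β : ℝ}

lemma isWeakFracDeriv_left_iff_of_lt_one (hΩ : IsOpen Ω) (hα : 0 < α) (hα1 : α < 1) :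
    IsWeakFracDeriv .left Ω α u v ↔ IntegrableOn u Ω ∧ LocallyIntegrableOn v Ω ∧
      ∀ φ, IsTestFunction Ω φ → ∫ x in Ω, v x * φ x =
        -∫ x, Ω.indicator u x * rightInt (1 - α) (deriv φ) x := by
  have hf : ⌊α⌋₊ = 0 := Nat.floor_eq_zero.2 hα1
  have hne : (⌊α⌋₊ : ℝ) ≠ α := by rw [hf]; simpa using hα.ne
  rw [isWeakFracDeriv_left_iff hne, hf]
  simp only [setIntegral_mul_eq_indicator hΩ.measurableSet u, Nat.cast_zero, zero_add,
    iteratedDeriv_one]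

lemma floor_ne_self (hα : 0 < α) (hα1 : α < 1) : (⌊α⌋₊ : ℝ) ≠ α := by
  rw [Nat.floor_eq_zero.2 hα1]; simpa using hα.ne

/-- Transfer of the fractional integrals across, for smooth right factors. -/
lemma integral_leftInt_mul_rightInt_deriv {γ δ : ℝ} (hγ : 0 < γ) (hγ1 : γ ≤ 1) (hδ : 0 < δ)
    (hδ1 : δ < 1) (hu : Integrable u) {φ : ℝ → ℝ} (hφ : IsTestFunction Ω φ) :
    ∫ x, leftInt γ u x * rightInt δ (deriv φ) x = ∫ x, u x * rightInt (γ + δ) (deriv φ) x := by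
  obtain ⟨M, -, hM⟩ := hφ.deriv.abs_rightInt_le hδ hδ1.le
  rw [← integral_mul_rightInt hγ hγ1 hu (hφ.integrable_rightInt_deriv hδ hδ1) hM]
  simp only [hφ.deriv.rightInt_rightInt hγ hδ]

/-- Since `I^{1-α} = I^{β-α} I^{1-β}`, the Marchaud derivative with `γ = β - α` of the weakly
differentiable `I^{1-β} u` is the required derivative. -/
lemma IsWeakFracDeriv.exists_of_lt_left (hΩ : IsOpen Ω) (hc : Ω.OrdConnected) (hn : Ω.Nonempty)
    (hα : 0 < α) (hαβ : α < β) (hβ : β < 1) (h : IsWeakFracDeriv .left Ω β u v) :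
    ∃ w, IsWeakFracDeriv .left Ω α u w := by
  obtain ⟨hu, hJ⟩ := (isWeakFracDeriv_left_iff_isWeakDeriv hΩ (hα.trans hαβ) hβ).1 h
  have hui := integrable_indicator_of hΩ hu
  obtain ⟨h1, h2⟩ := marchaud_of_isWeakDeriv (γ := β - α) hΩ hc hn
    (UnifLocIntegrable.leftInt (γ := 1 - β) (by linarith) (by linarith) hui) hJ (by linarith)
    (by linarith)
  refine ⟨_, (isWeakFracDeriv_left_iff_of_lt_one hΩ hα (hαβ.trans hβ)).2
    ⟨hu, h1, fun φ hφ => ?_⟩⟩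
  rw [h2 φ hφ, integral_leftInt_mul_rightInt_deriv (by linarith) (by linarith) (by linarith)
    (by linarith) hui hφ, show 1 - β + (β - α) = 1 - α by ring]

lemma IsWeakFracDeriv.exists_of_lt {s : Side} (hΩ : IsDomain Ω) (hα : 0 < α) (hαβ : α < β)
    (hβ : β < 1) (h : IsWeakFracDeriv s Ω β u v) : ∃ w, IsWeakFracDeriv s Ω α u w := by
  cases s with
  | left => exact h.exists_of_lt_left hΩ.isOpen hΩ.ordConnected hΩ.nonempty hα hαβ hβ
  | right =>
    rw [isWeakFracDeriv_right_iff hΩ.isOpen (floor_ne_self (hα.trans hαβ) hβ)] at h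
    obtain ⟨w, hw⟩ := h.exists_of_lt_left hΩ.neg.isOpen hΩ.neg.ordConnected hΩ.neg.nonempty
      hα hαβ hβ
    refine ⟨fun x => w (-x), ?_⟩
    rw [isWeakFracDeriv_right_iff hΩ.isOpen (floor_ne_self hα (hαβ.trans hβ))]
    simpa using hw

end inclusivity

/-! ### Consistency with the first weak derivative -/

section consistency

variable {Ω : Set ℝ} {u w : ℝ → ℝ} {α : ℝ}

lemma isWeakDeriv_indicator (hΩ : IsOpen Ω) (hu : IntegrableOn u Ω) (h : IsWeakDeriv Ω 1 u w) :
    IsWeakDeriv Ω 1 (Ω.indicator u) w := by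
  refine ⟨(integrable_indicator_of hΩ hu).locallyIntegrable.locallyIntegrableOn Ω, h.2.1,
    fun φ hφ => ?_⟩
  rw [h.2.2 φ hφ]
  congr 1
  refine setIntegral_congr_fun hΩ.measurableSet fun x hx => ?_
  rw [indicator_of_mem hx]

lemma isWeakFracDeriv_marchaud (hΩ : IsOpen Ω) (hc : Ω.OrdConnected) (hn : Ω.Nonempty)
    (hα : 0 < α) (hα1 : α < 1) (hu : IntegrableOn u Ω) (h : IsWeakDeriv Ω 1 u w) :
    IsWeakFracDeriv .left Ω α u (marchaud (1 - α) (Ω.indicator u)) := by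
  obtain ⟨h1, h2⟩ := marchaud_of_isWeakDeriv (γ := 1 - α) hΩ hc hn
    (integrable_indicator_of hΩ hu).unifLocIntegrable (isWeakDeriv_indicator hΩ hu h)
    (by linarith) (by linarith)
  exact (isWeakFracDeriv_left_iff_of_lt_one hΩ hα hα1).2 ⟨hu, h1, h2⟩

/-- The pole of `Γ` at `0` is avoided by writing `1 / Γ(γ) = γ / Γ(γ + 1)`. -/
lemma tendsto_inv_Gamma : Tendsto (fun γ : ℝ => γ * (Real.Gamma (γ + 1))⁻¹) (𝓝[>] 0) (𝓝 0) ∧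
    Tendsto (fun γ : ℝ => (Real.Gamma (γ + 1))⁻¹) (𝓝[>] 0) (𝓝 1) := by
  have h1 : ContinuousAt (fun γ : ℝ => (Real.Gamma (γ + 1))⁻¹) 0 := by
    have hd : DifferentiableAt ℝ Real.Gamma (0 + 1) :=
      Real.differentiableAt_Gamma fun m => by
        have : (0 : ℝ) ≤ m := Nat.cast_nonneg m
        intro h; linarith
    refine ContinuousAt.inv₀ ?_ (by simp)
    exact ContinuousAt.comp (f := fun γ : ℝ => γ + 1) (g := Real.Gamma) hd.continuousAt
      (by fun_prop)
  have h2 : Tendsto (fun γ : ℝ => (Real.Gamma (γ + 1))⁻¹) (𝓝[>] 0) (𝓝 1) := by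
    have := h1.tendsto.mono_left (nhdsWithin_le_nhds (s := Ioi 0))
    simpa using this
  refine ⟨?_, h2⟩
  have := (tendsto_id.mono_left (nhdsWithin_le_nhds (s := Ioi (0 : ℝ)))).mul h2
  simpa using this

lemma inv_Gamma_eq {γ : ℝ} (hγ : 0 < γ) :
    (Real.Gamma γ)⁻¹ = γ * (Real.Gamma (γ + 1))⁻¹ := by
  have := (Real.Gamma_pos_of_pos hγ).ne'
  rw [Real.Gamma_add_one hγ.ne']
  field_simp

/-- Near zero the increment is replaced by `l t` with error `ε t`; both integrate to multiples of
`δ^γ / γ`, whose `1 / γ` is absorbed by `1 / Γ(γ)`. The part beyond `δ` keeps the factor `1 / Γ(γ)`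
and so disappears as `γ → 0`. -/
lemma abs_marchaud_sub_le {f : ℝ → ℝ} (hf : Integrable f) {x l ε δ γ : ℝ} (hδ : 0 < δ)
    (h : ∀ᵐ t, t ∈ Ioc 0 δ → |f x - f (x - t) - l * t| ≤ ε * t) (hγ : 0 < γ) (hγ1 : γ < 1) :
    |marchaud γ f x - l * ((1 - γ) * (Real.Gamma (γ + 1))⁻¹ * δ ^ γ)| ≤
      (1 - γ) * (Real.Gamma (γ + 1))⁻¹ * (ε * δ ^ γ) + (1 - γ) * (γ * (Real.Gamma (γ + 1))⁻¹) *
        (|f x| * (δ ^ (γ - 1) / (1 - γ)) + (∫ y, |f y|) * δ ^ (γ - 2)) := by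
  have hfm : AEStronglyMeasurable fun t => f x - f (x - t) :=
    aestronglyMeasurable_const.sub (hf.comp_sub_left x).aestronglyMeasurable
  have hrm : Measurable fun t : ℝ => t ^ (γ - 2) := by fun_prop
  have hpow : ∀ t : ℝ, 0 < t → t * t ^ (γ - 2) = t ^ (γ - 1) := fun t ht => by
    rw [show γ - 1 = γ - 2 + 1 by ring, Real.rpow_add_one ht.ne', mul_comm]
  have hI1 : IntegrableOn (fun t : ℝ => t ^ (γ - 1)) (Ioc 0 δ) :=
    (intervalIntegrable_iff_integrableOn_Ioc_of_le hδ.le).1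
      (intervalIntegral.intervalIntegrable_rpow' (by linarith))
  have hI1v : ∫ t in Ioc 0 δ, t ^ (γ - 1) = δ ^ γ / γ := by
    rw [← intervalIntegral.integral_of_le hδ.le, integral_rpow (Or.inl (by linarith))]
    simp [hγ.ne']
  have hE : IntegrableOn (fun t => (f x - f (x - t) - l * t) * t ^ (γ - 2)) (Ioc 0 δ) := by
    refine Integrable.mono' (hI1.const_mul ε) ?_ ?_
    · exact ((hfm.sub (by fun_prop)).mul hrm.aestronglyMeasurable).restrict
    · rw [ae_restrict_iff' measurableSet_Ioc]
      filter_upwards [h] with t ht hm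
      rw [norm_mul, Real.norm_of_nonneg (Real.rpow_nonneg hm.1.le _), ← hpow t hm.1, ← mul_assoc]
      exact mul_le_mul_of_nonneg_right (ht hm) (Real.rpow_nonneg hm.1.le _)
  have hEv : |∫ t in Ioc 0 δ, (f x - f (x - t) - l * t) * t ^ (γ - 2)| ≤ ε * (δ ^ γ / γ) := by
    rw [← hI1v, ← integral_const_mul]
    rw [← Real.norm_eq_abs]
    refine norm_integral_le_of_norm_le (hI1.const_mul ε) ?_
    rw [ae_restrict_iff' measurableSet_Ioc]
    filter_upwards [h] with t ht hm
    rw [norm_mul, Real.norm_of_nonneg (Real.rpow_nonneg hm.1.le _), ← hpow t hm.1, ← mul_assoc]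
    exact mul_le_mul_of_nonneg_right (ht hm) (Real.rpow_nonneg hm.1.le _)
  have hI2 : IntegrableOn (fun t : ℝ => t ^ (γ - 2)) (Ioi δ) :=
    integrableOn_Ioi_rpow_of_lt (by linarith) hδ
  have hI2v : ∫ t in Ioi δ, t ^ (γ - 2) = δ ^ (γ - 1) / (1 - γ) := by
    rw [integral_Ioi_rpow_of_lt (by linarith) hδ, show γ - 2 + 1 = -(1 - γ) by ring,
      div_neg, neg_div, neg_neg, neg_sub]
  have hBi : IntegrableOn (fun t => |f x| * t ^ (γ - 2) + |f (x - t)| * δ ^ (γ - 2)) (Ioi δ) :=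
    (hI2.const_mul _).add ((hf.comp_sub_left x).abs.mul_const _).integrableOn
  have hBle : ∀ t ∈ Ioi δ, ‖(f x - f (x - t)) * t ^ (γ - 2)‖ ≤
      |f x| * t ^ (γ - 2) + |f (x - t)| * δ ^ (γ - 2) := by
    intro t ht
    have ht0 : 0 < t := hδ.trans ht
    have hp := Real.rpow_nonneg ht0.le (γ - 2)
    have hle : t ^ (γ - 2) ≤ δ ^ (γ - 2) :=
      Real.rpow_le_rpow_of_nonpos hδ (le_of_lt ht) (by linarith)
    rw [norm_mul, Real.norm_of_nonneg hp]
    calc ‖f x - f (x - t)‖ * t ^ (γ - 2) ≤ (|f x| + |f (x - t)|) * t ^ (γ - 2) :=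
          mul_le_mul_of_nonneg_right (norm_sub_le _ _) hp
      _ ≤ _ := by
          rw [add_mul]
          exact add_le_add le_rfl (mul_le_mul_of_nonneg_left hle (abs_nonneg _))
  have hT : IntegrableOn (fun t => (f x - f (x - t)) * t ^ (γ - 2)) (Ioi δ) :=
    Integrable.mono' hBi (hfm.mul hrm.aestronglyMeasurable).restrict
      ((ae_restrict_iff' measurableSet_Ioi).2 (ae_of_all _ hBle))
  have hTv : |∫ t in Ioi δ, (f x - f (x - t)) * t ^ (γ - 2)| ≤
      |f x| * (δ ^ (γ - 1) / (1 - γ)) + (∫ y, |f y|) * δ ^ (γ - 2) := by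
    rw [← Real.norm_eq_abs]
    refine (norm_integral_le_of_norm_le hBi
      ((ae_restrict_iff' measurableSet_Ioi).2 (ae_of_all _ hBle))).trans ?_
    rw [integral_add (hI2.const_mul _) ((hf.comp_sub_left x).abs.mul_const _).integrableOn,
      integral_const_mul, hI2v, integral_mul_const]
    refine add_le_add le_rfl (mul_le_mul_of_nonneg_right ?_ (Real.rpow_nonneg hδ.le _))
    refine (setIntegral_le_integral (hf.comp_sub_left x).abs
      (ae_of_all _ fun _ => abs_nonneg _)).trans (le_of_eq ?_)
    exact integral_sub_left_eq_self (fun y => |f y|) volume x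
  have hN : EqOn (fun t => (f x - f (x - t) - l * t) * t ^ (γ - 2) + l * t ^ (γ - 1))
      (fun t => (f x - f (x - t)) * t ^ (γ - 2)) (Ioc 0 δ) := fun t ht => by
    simp only
    rw [← hpow t ht.1]
    ring
  have hsplit : ∫ t in Ioi 0, (f x - f (x - t)) * t ^ (γ - 2) =
      ((∫ t in Ioc 0 δ, (f x - f (x - t) - l * t) * t ^ (γ - 2)) + l * (δ ^ γ / γ)) +
        ∫ t in Ioi δ, (f x - f (x - t)) * t ^ (γ - 2) := by
    rw [← Ioc_union_Ioi_eq_Ioi hδ.le, setIntegral_union (Ioc_disjoint_Ioi le_rfl)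
      measurableSet_Ioi (IntegrableOn.congr_fun (hE.add (hI1.const_mul l)) hN measurableSet_Ioc)
      hT, ← setIntegral_congr_fun measurableSet_Ioc hN, integral_add hE (hI1.const_mul l),
      integral_const_mul, hI1v]
  unfold marchaud
  rw [hsplit, div_eq_mul_inv, inv_Gamma_eq hγ]
  set E := ∫ t in Ioc 0 δ, (f x - f (x - t) - l * t) * t ^ (γ - 2)
  set T := ∫ t in Ioi δ, (f x - f (x - t)) * t ^ (γ - 2)
  have hG : 0 < (Real.Gamma (γ + 1))⁻¹ := inv_pos.2 (Real.Gamma_pos_of_pos (by linarith))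
  set g := (Real.Gamma (γ + 1))⁻¹
  have e1 : (1 - γ) * (γ * g) * (E + l * (δ ^ γ / γ) + T) - l * ((1 - γ) * g * δ ^ γ) =
      (1 - γ) * (γ * g) * E + (1 - γ) * (γ * g) * T := by
    field_simp
    ring
  have e2 : (1 - γ) * g * (ε * δ ^ γ) = (1 - γ) * (γ * g) * (ε * (δ ^ γ / γ)) := by
    field_simp
  have hp : 0 ≤ (1 - γ) * (γ * g) := mul_nonneg (by linarith) (mul_nonneg hγ.le hG.le)
  rw [e1, e2]
  refine (abs_add_le _ _).trans (add_le_add ?_ ?_)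
  · rw [abs_mul, abs_of_nonneg hp]
    exact mul_le_mul_of_nonneg_left hEv hp
  · rw [abs_mul, abs_of_nonneg hp]
    exact mul_le_mul_of_nonneg_left hTv hp

/-- As its order tends to one, the Marchaud derivative tends to the one-sided derivative. -/
lemma tendsto_marchaud {f : ℝ → ℝ} (hf : Integrable f) {x l : ℝ}
    (h : ∀ ε > 0, ∃ δ > 0, ∀ᵐ t, t ∈ Ioc 0 δ → |f x - f (x - t) - l * t| ≤ ε * t) :
    Tendsto (fun γ => marchaud γ f x) (𝓝[>] 0) (𝓝 l) := by
  obtain ⟨hG0, hG1⟩ := tendsto_inv_Gamma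
  rw [Metric.tendsto_nhds]
  intro ε hε
  obtain ⟨δ, hδ, hδ'⟩ := h (ε / 3) (by positivity)
  have hid : Tendsto (fun γ : ℝ => γ) (𝓝[>] 0) (𝓝 0) := tendsto_id.mono_left nhdsWithin_le_nhds
  have h1 : Tendsto (fun γ : ℝ => 1 - γ) (𝓝[>] 0) (𝓝 1) := by simpa using hid.const_sub 1
  have hpow : ∀ c : ℝ, Tendsto (fun γ : ℝ => δ ^ (γ - c)) (𝓝[>] 0) (𝓝 (δ ^ (-c))) := by
    intro c
    have := (Real.continuousAt_const_rpow (b := -c) hδ.ne').tendsto.comp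
      (f := fun γ : ℝ => γ - c) (x := 𝓝[>] 0) (by simpa using hid.sub_const c)
    exact this
  have hpow0 : Tendsto (fun γ : ℝ => δ ^ γ) (𝓝[>] 0) (𝓝 1) := by simpa using hpow 0
  have hA : Tendsto (fun γ : ℝ => l * ((1 - γ) * (Real.Gamma (γ + 1))⁻¹ * δ ^ γ)) (𝓝[>] 0)
      (𝓝 l) := by
    simpa using ((h1.mul hG1).mul hpow0).const_mul l
  have hB : Tendsto (fun γ : ℝ => (1 - γ) * (Real.Gamma (γ + 1))⁻¹ * (ε / 3 * δ ^ γ) +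
      (1 - γ) * (γ * (Real.Gamma (γ + 1))⁻¹) *
        (|f x| * (δ ^ (γ - 1) / (1 - γ)) + (∫ y, |f y|) * δ ^ (γ - 2))) (𝓝[>] 0) (𝓝 (ε / 3)) := by
    have := ((h1.mul hG1).mul (hpow0.const_mul (ε / 3))).add ((h1.mul hG0).mul
      ((((hpow 1).div h1 one_ne_zero).const_mul |f x|).add ((hpow 2).const_mul (∫ y, |f y|))))
    simpa using this
  -- The error bound tends to `ε / 3`, hence is eventually below `2 ε / 3`; the main term
  -- contributes the last `ε / 3`.
  filter_upwards [Metric.tendsto_nhds.1 hA (ε / 3) (by positivity),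
    hB.eventually_lt_const (show ε / 3 < 2 * (ε / 3) by linarith),
    Ioo_mem_nhdsGT (zero_lt_one' ℝ)] with γ ha hb hγ
  have hc := abs_marchaud_sub_le hf hδ hδ' hγ.1 hγ.2
  rw [Real.dist_eq] at ha ⊢
  rw [abs_lt] at ha ⊢
  rw [abs_le] at hc
  constructor <;> linarith [ha.1, ha.2, hc.1, hc.2]

/-- A weakly differentiable `f` equals its continuous representative `F` only almost everywhere.
Agreement at `x` and at almost every nearby point to its left is all the integral sees. -/
lemma tendsto_marchaud_of_hasDerivAt {f F : ℝ → ℝ} (hf : Integrable f) {x l : ℝ}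
    (hF : HasDerivAt F l x) (hx : f x = F x)
    (hfF : ∃ δ > 0, ∀ᵐ t, t ∈ Ioc 0 δ → f (x - t) = F (x - t)) :
    Tendsto (fun γ => marchaud γ f x) (𝓝[>] 0) (𝓝 l) := by
  refine tendsto_marchaud hf fun ε hε => ?_
  obtain ⟨δ₁, hδ₁, h1⟩ := hfF
  have h2 := (hasDerivAt_iff_isLittleO.1 hF).def hε
  obtain ⟨δ₂, hδ₂, h3⟩ := Metric.nhds_basis_closedBall.mem_iff.1 h2
  refine ⟨min δ₁ δ₂, lt_min hδ₁ hδ₂, ?_⟩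
  filter_upwards [h1] with t ht hm
  have h4 : x - t ∈ Metric.closedBall x δ₂ := by
    rw [Metric.mem_closedBall, Real.dist_eq, sub_sub_cancel_left, abs_neg, abs_of_pos hm.1]
    exact hm.2.trans (min_le_right _ _)
  have h5 := h3 h4
  simp only [mem_ofPred_eq, sub_sub_cancel_left, smul_eq_mul, Real.norm_eq_abs, abs_neg,
    abs_of_pos hm.1] at h5
  rw [hx, ht ⟨hm.1, hm.2.trans (min_le_left _ _)⟩, ← abs_neg]
  refine le_of_eq_of_le ?_ h5
  congr 1; ring

lemma ae_hasDerivAt_primitive (hΩ : IsOpen Ω) (hc : Ω.OrdConnected)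
    (hw : LocallyIntegrableOn w Ω) {x₀ : ℝ} (hx₀ : x₀ ∈ Ω) :
    ∀ᵐ x, x ∈ Ω → HasDerivAt (fun y => ∫ t in x₀..y, w t) (w x) x := by
  refine ae_of_mem_of_ae_of_mem_inter_Ioo fun a b ha hb hab => ?_
  filter_upwards [(intervalIntegrable_of_mem hc hw ha hb).ae_hasDerivAt_integral] with x hx hxm
  have h1 := hx (by rw [uIcc_of_le hab.le]; exact Ioo_subset_Icc_self hxm.2) a left_mem_uIcc
  refine (h1.const_add (∫ t in x₀..a, w t)).congr_of_eventuallyEq ?_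
  filter_upwards [hΩ.mem_nhds hxm.1] with y hy
  exact (intervalIntegral.integral_add_adjacent_intervals
    (intervalIntegrable_of_mem hc hw hx₀ ha) (intervalIntegrable_of_mem hc hw ha hy)).symm

lemma IsWeakDeriv.ae_tendsto_marchaud (hΩ : IsOpen Ω) (hc : Ω.OrdConnected) (hn : Ω.Nonempty)
    {f : ℝ → ℝ} (hf : Integrable f) (h : IsWeakDeriv Ω 1 f w) :
    ∀ᵐ x, x ∈ Ω → Tendsto (fun γ => marchaud γ f x) (𝓝[>] 0) (𝓝 (w x)) := by
  obtain ⟨x₀, hx₀⟩ := hn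
  obtain ⟨C, hC⟩ := h.exists_eq_primitive hΩ hc hx₀
  filter_upwards [ae_hasDerivAt_primitive hΩ hc h.2.1 hx₀, hC] with x h1 h2 hx
  obtain ⟨r, hr, hb⟩ := Metric.nhds_basis_closedBall.mem_iff.1 (hΩ.mem_nhds hx)
  refine tendsto_marchaud_of_hasDerivAt hf ((h1 hx).const_add C) (h2 hx) ⟨r, hr, ?_⟩
  filter_upwards [(Measure.measurePreserving_sub_left volume x).quasiMeasurePreserving.ae hC]
    with t ht hm
  refine ht (hb ?_)
  rw [Metric.mem_closedBall, Real.dist_eq, sub_sub_cancel_left, abs_neg, abs_of_pos hm.1]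
  exact hm.2

/-- Up to sign this is the Marchaud derivative of the reflected test function at `-x`. -/
lemma IsTestFunction.tendsto_rightInt_deriv {φ : ℝ → ℝ} (h : IsTestFunction Ω φ) (x : ℝ) :
    Tendsto (fun γ => rightInt γ (_root_.deriv φ) x) (𝓝[>] 0) (𝓝 (_root_.deriv φ x)) := by
  have hd : HasDerivAt (fun y => φ (-y)) (-_root_.deriv φ x) (-x) := by
    have := h.comp_neg.hasDerivAt (-x)
    rwa [deriv_comp_neg, neg_neg] at this
  have h1 := (tendsto_marchaud_of_hasDerivAt h.comp_neg.integrable hd rfl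
    ⟨1, one_pos, ae_of_all _ fun _ _ => rfl⟩).neg
  rw [neg_neg] at h1
  refine h1.congr' ?_
  filter_upwards [Ioo_mem_nhdsGT (zero_lt_one' ℝ)] with γ hγ
  rw [h.rightInt_deriv_eq hγ.1 hγ.2, marchaud]
  simp [add_comm]

lemma tendsto_one_sub : Tendsto (fun α : ℝ => 1 - α) (𝓝[<] 1) (𝓝[>] 0) := by
  refine tendsto_nhdsWithin_iff.2 ⟨?_, ?_⟩
  · have : Tendsto (fun α : ℝ => 1 - α) (𝓝 1) (𝓝 (1 - 1)) := by
      exact (continuous_const.sub continuous_id).tendsto 1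
    rw [sub_self] at this
    exact this.mono_left nhdsWithin_le_nhds
  · filter_upwards [self_mem_nhdsWithin] with α hα
    exact sub_pos.2 (show α < 1 from hα)

lemma tendsto_integral_mul_rightInt_deriv {f φ : ℝ → ℝ} (hf : Integrable f)
    (hφ : IsTestFunction Ω φ) :
    Tendsto (fun γ => ∫ x, f x * rightInt γ (deriv φ) x) (𝓝[>] 0)
      (𝓝 (∫ x, f x * deriv φ x)) := by
  obtain ⟨M, -, hM⟩ := hφ.deriv.exists_bound
  obtain ⟨hG0, hG1⟩ := tendsto_inv_Gamma
  have hB : Tendsto (fun γ : ℝ => M * (Real.Gamma (γ + 1))⁻¹ +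
      (∫ t, |deriv φ t|) * (γ * (Real.Gamma (γ + 1))⁻¹)) (𝓝[>] 0) (𝓝 M) := by
    simpa using (hG1.const_mul M).add (hG0.const_mul (∫ t, |deriv φ t|))
  -- The uniform bound on the fractional integral tends to `M`, so `M + 1` dominates once `γ` is
  -- small.
  refine tendsto_integral_filter_of_dominated_convergence (fun x => |f x| * (M + 1)) ?_ ?_
    (hf.abs.mul_const _) (ae_of_all _ fun x => (hφ.tendsto_rightInt_deriv x).const_mul _)
  · filter_upwards [self_mem_nhdsWithin] with γ hγ
    exact hf.1.mul (continuous_rightInt hγ hφ.deriv).aestronglyMeasurable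
  · filter_upwards [hB.eventually_lt_const (lt_add_one M), Ioo_mem_nhdsGT (zero_lt_one' ℝ)]
      with γ hγ hγ'
    refine ae_of_all _ fun x => ?_
    rw [norm_mul]
    refine mul_le_mul_of_nonneg_left ?_ (abs_nonneg _)
    refine (abs_rightInt_le hγ'.1 hγ'.2.le hφ.deriv.integrable hM x).trans ?_
    rw [div_eq_mul_inv, div_eq_mul_inv, inv_Gamma_eq hγ'.1]
    exact hγ.le

lemma tendsto_integral_left (hΩ : IsOpen Ω) (hu : IntegrableOn u Ω) (h : IsWeakDeriv Ω 1 u w)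
    {v : ℝ → ℝ → ℝ} (hv : ∀ α ∈ Ioo (0 : ℝ) 1, IsWeakFracDeriv .left Ω α u (v α))
    {φ : ℝ → ℝ} (hφ : IsTestFunction Ω φ) :
    Tendsto (fun α : ℝ => ∫ x in Ω, v α x * φ x) (𝓝[<] 1) (𝓝 (∫ x in Ω, w x * φ x)) := by
  have h1 := ((tendsto_integral_mul_rightInt_deriv (integrable_indicator_of hΩ hu)
    hφ).comp tendsto_one_sub).neg
  rw [← setIntegral_mul_eq_indicator hΩ.measurableSet,
    ← (isWeakDeriv_one_iff.1 h).2.2 φ hφ] at h1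
  refine h1.congr' ?_
  filter_upwards [Ioo_mem_nhdsLT (zero_lt_one' ℝ)] with α hα
  exact (((isWeakFracDeriv_left_iff_of_lt_one hΩ hα.1 hα.2).1 (hv α hα)).2.2 φ hφ).symm

lemma ae_tendsto_left (hΩ : IsOpen Ω) (hc : Ω.OrdConnected) (hn : Ω.Nonempty)
    (hu : IntegrableOn u Ω) (h : IsWeakDeriv Ω 1 u w) {a : ℕ → ℝ} {v : ℕ → ℝ → ℝ}
    (ha : ∀ k, a k ∈ Ioo (0 : ℝ) 1) (ha1 : Tendsto a atTop (𝓝 1))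
    (hv : ∀ k, IsWeakFracDeriv .left Ω (a k) u (v k)) :
    ∀ᵐ x, x ∈ Ω → Tendsto (fun k => v k x) atTop (𝓝 (w x)) := by
  -- Each `v k` is determined only up to a null set; a sequence of orders leaves countably many of
  -- these to discard.
  have h1 : ∀ᵐ x, ∀ k, x ∈ Ω → v k x = marchaud (1 - a k) (Ω.indicator u) x := by
    rw [ae_all_iff]
    intro k
    have hm := isWeakFracDeriv_marchaud hΩ hc hn (ha k).1 (ha k).2 hu h
    exact ae_eq_of_integral_test_eq hΩ (hv k).2.1 hm.2.1 fun φ hφ => by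
      rw [(hv k).2.2 φ hφ, hm.2.2 φ hφ]
  filter_upwards [h1, (isWeakDeriv_indicator hΩ hu h).ae_tendsto_marchaud hΩ hc hn
    (integrable_indicator_of hΩ hu)] with x h2 h3 hx
  have ha' : Tendsto a atTop (𝓝[<] 1) :=
    tendsto_nhdsWithin_iff.2 ⟨ha1, Eventually.of_forall fun k => (ha k).2⟩
  refine ((h3 hx).comp (tendsto_one_sub.comp ha')).congr fun k => ?_
  exact (h2 k hx).symm

end consistency

/-! ### The semigroup property -/

section semigroup

variable {Ω : Set ℝ} {u q r w J : ℝ → ℝ} {α β γ δ a b : ℝ}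

lemma abs_leftInt_one_le (hq : Integrable q) (x : ℝ) : |leftInt 1 q x| ≤ ∫ t, |q t| := by
  rw [leftInt_one]
  exact (abs_integral_le_integral_abs).trans
    (setIntegral_le_integral hq.abs (ae_of_all _ fun _ => abs_nonneg _))

lemma leftInt_one_sub (hq : Integrable q) (x y : ℝ) :
    leftInt 1 q y - leftInt 1 q x = ∫ t in x..y, q t := by
  rw [leftInt_one, leftInt_one, ← integral_Iic_eq_integral_Iio, ← integral_Iic_eq_integral_Iio,
    intervalIntegral.integral_Iic_sub_Iic hq.integrableOn hq.integrableOn]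

lemma continuous_leftInt_one (hq : Integrable q) : Continuous (leftInt 1 q) := by
  have h : leftInt 1 q = fun y => leftInt 1 q 0 + ∫ t in (0 : ℝ)..y, q t := by
    ext y
    rw [← leftInt_one_sub hq]
    ring
  rw [h]
  exact continuous_const.add (intervalIntegral.continuous_primitive
    (fun _ _ => hq.intervalIntegrable) 0)

lemma leftInt_eq_zero (hu : ∀ y, y ≤ a → u y = 0) {x : ℝ} (hx : x ≤ a) : leftInt γ u x = 0 := by
  unfold leftInt
  rw [show (fun t => rlKernel γ t * u (x - t)) = fun _ => 0 from ?_, integral_zero]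
  ext t
  rcases le_or_gt t 0 with ht | ht
  · rw [rlKernel_of_nonpos ht, zero_mul]
  · rw [hu _ (by linarith), mul_zero]

/-- A function whose weak derivative is integrable is, up to a constant, the primitive of its
extension by zero. -/
lemma IsWeakDeriv.exists_eq_leftInt_one (hΩ : IsOpen Ω) (hc : Ω.OrdConnected) (hn : Ω.Nonempty)
    (hq : IntegrableOn q Ω) (h : IsWeakDeriv Ω 1 J q) :
    ∃ C, ∀ᵐ x, x ∈ Ω → J x = C + leftInt 1 (Ω.indicator q) x := by
  obtain ⟨x₀, hx₀⟩ := hn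
  obtain ⟨C, hC⟩ := h.exists_eq_primitive hΩ hc hx₀
  have hqi := integrable_indicator_of hΩ hq
  refine ⟨C - leftInt 1 (Ω.indicator q) x₀, ?_⟩
  filter_upwards [hC] with x hx hxΩ
  have h1 : ∫ t in x₀..x, Ω.indicator q t = ∫ t in x₀..x, q t :=
    intervalIntegral.integral_congr fun t ht =>
      indicator_of_mem (hc.uIcc_subset hx₀ hxΩ ht) _
  rw [hx hxΩ, ← h1, ← leftInt_one_sub hqi]
  ring

/-- Composition holds wherever the integral of order `γ + δ` converges absolutely, which Fubini
against the indicator of `(a, b)` gives for almost every point. -/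
lemma ae_leftInt_leftInt (hγ : 0 < γ) (hδ : 0 < δ) (hγδ : γ + δ ≤ 1) (hu : Integrable u)
    (a b : ℝ) : ∀ᵐ x, x ∈ Ioo a b → leftInt γ (leftInt δ u) x = leftInt (γ + δ) u x := by
  have hi : Integrable ((Ioo a b).indicator fun _ => (1 : ℝ)) := by
    rw [integrable_indicator_iff measurableSet_Ioo]
    exact integrableOn_const (by simp)
  have hbd : ∀ x : ℝ, |(Ioo a b).indicator (fun _ => (1 : ℝ)) x| ≤ 1 := fun x => by
    by_cases h : x ∈ Ioo a b <;> simp [h]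
  have h := integrable_prod_left (add_pos hγ hδ) hγδ hu hi hbd
  rw [Measure.volume_eq_prod] at h
  filter_upwards [h.prod_right_ae] with x hx hxm
  simp only [indicator_of_mem hxm, mul_one] at hx
  have h1 : (fun y => leftInt δ u (-y)) = rightInt δ fun y => u (-y) := by
    ext y
    rw [leftInt_eq_rightInt, neg_neg]
  rw [leftInt_eq_rightInt, h1, leftInt_eq_rightInt (γ + δ)]
  have hum : AEStronglyMeasurable fun y => u (-y) :=
    hu.1.comp_quasiMeasurePreserving (Measure.measurePreserving_neg volume).quasiMeasurePreserving
  refine rightInt_rightInt hγ hδ hum (hx.congr (ae_of_all _ fun t => ?_))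
  simp only [neg_add, neg_neg]
  rw [sub_eq_add_neg]

/-- The fractional integral of a function that vanishes on `(-∞, a]` and is bounded by `B` on
`(a, b)`. -/
lemma abs_leftInt_le_rpow (hγ : 0 < γ) {H : ℝ → ℝ} {B : ℝ} (h0 : ∀ y, y ≤ a → H y = 0)
    (hB : ∀ᵐ y, y ∈ Ioo a b → |H y| ≤ B) {x : ℝ} (hx : x ∈ Ioo a b) :
    |leftInt γ H x| ≤ B * ((x - a) ^ γ / Real.Gamma (γ + 1)) := by
  rw [← integral_rlKernel_Ioc hγ (sub_nonneg.2 hx.1.le), ← integral_const_mul,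
    ← integral_indicator measurableSet_Ioc, ← Real.norm_eq_abs]
  refine norm_integral_le_of_norm_le ?_ ?_
  · rw [integrable_indicator_iff measurableSet_Ioc]
    exact (integrableOn_rlKernel_Ioc hγ _).const_mul B
  · have hne : ∀ᵐ t : ℝ, t ≠ x - a := by simp [ae_iff]
    filter_upwards [(Measure.measurePreserving_sub_left volume x).quasiMeasurePreserving.ae hB,
      hne] with t ht hta
    rw [norm_mul, Real.norm_of_nonneg (rlKernel_nonneg hγ t), Real.norm_eq_abs]
    by_cases hm : t ∈ Ioc 0 (x - a)
    · rw [indicator_of_mem hm, mul_comm]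
      refine mul_le_mul_of_nonneg_right (ht ⟨?_, ?_⟩) (rlKernel_nonneg hγ t)
      · have := lt_of_le_of_ne hm.2 hta
        linarith
      · linarith [hm.1, hx.2]
    · rw [indicator_of_notMem hm]
      rcases le_or_gt t 0 with h | h
      · rw [rlKernel_of_nonpos h, zero_mul]
      · rw [h0 (x - t), abs_zero, mul_zero]
        by_contra h'
        exact hm ⟨h, by linarith⟩

lemma eq_zero_of_ae_le {C : ℝ} {g : ℝ → ℝ} (hab : a < b) (hg : ContinuousAt g a) (h0 : g a = 0)
    (h : ∀ᵐ x, x ∈ Ioo a b → |C| ≤ g x) : C = 0 := by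
  by_contra hC
  have hlt : g a < |C| := by rw [h0]; exact abs_pos.2 hC
  obtain ⟨η, hη, hb⟩ := Metric.nhds_basis_ball.mem_iff.1 (hg.eventually_lt_const hlt)
  have hne : (ae (volume.restrict (Ioo a (min b (a + η))))).NeBot := by
    rw [ae_restrict_neBot, Real.volume_Ioo]
    have : 0 < min b (a + η) - a := sub_pos.2 (lt_min hab (by linarith))
    simpa using this
  have h1 : ∀ᵐ x ∂volume.restrict (Ioo a (min b (a + η))), False := by
    rw [ae_restrict_iff' measurableSet_Ioo]
    filter_upwards [h] with x hx hm
    have h2 := hx ⟨hm.1, hm.2.trans_le (min_le_left _ _)⟩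
    have h3 : x ∈ Metric.ball a η := by
      rw [Metric.mem_ball, Real.dist_eq, abs_of_pos (sub_pos.2 hm.1)]
      linarith [hm.2.trans_le (min_le_right b (a + η))]
    exact absurd (hb h3) (not_lt.2 h2)
  exact h1.exists.elim fun _ h => h

/-- If the fractional integrals of complementary orders have integrable weak derivatives, the
boundary term at the left end point of an interval vanishes. -/
lemma ae_eq_leftInt_one_of_Ioo (hab : a < b) (hγ : 0 < γ) (hδ : 0 < δ) (hγδ : γ + δ ≤ 1)
    (hu : IntegrableOn u (Ioo a b)) (hq : IntegrableOn q (Ioo a b)) (hr : IntegrableOn r (Ioo a b))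
    (hJ : IsWeakDeriv (Ioo a b) 1 (leftInt (γ + δ) ((Ioo a b).indicator u)) q)
    (hH : IsWeakDeriv (Ioo a b) 1 (leftInt δ ((Ioo a b).indicator u)) r) :
    ∀ᵐ x, x ∈ Ioo a b → leftInt (γ + δ) ((Ioo a b).indicator u) x =
      leftInt 1 ((Ioo a b).indicator q) x := by
  have hn : (Ioo a b).Nonempty := nonempty_Ioo.2 hab
  have hz : ∀ (f : ℝ → ℝ) (y : ℝ), y ≤ a → (Ioo a b).indicator f y = 0 := fun f y hy =>
    indicator_of_notMem (fun h => absurd h.1 (not_lt.2 hy)) _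
  have hui := integrable_indicator_of isOpen_Ioo hu
  have hqi := integrable_indicator_of isOpen_Ioo hq
  have hri := integrable_indicator_of isOpen_Ioo hr
  obtain ⟨C, hC⟩ := hJ.exists_eq_leftInt_one isOpen_Ioo ordConnected_Ioo hn hq
  obtain ⟨D, hD⟩ := hH.exists_eq_leftInt_one isOpen_Ioo ordConnected_Ioo hn hr
  set B := |D| + ∫ t, |(Ioo a b).indicator r t|
  have hB : ∀ᵐ y, y ∈ Ioo a b → |leftInt δ ((Ioo a b).indicator u) y| ≤ B := by
    filter_upwards [hD] with y hy hm
    rw [hy hm]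
    exact (abs_add_le _ _).trans (add_le_add le_rfl (abs_leftInt_one_le hri y))
  have hC0 : C = 0 := by
    -- The comparison function bounds `|C|` near `a` and vanishes at `a`: its first term bounds
    -- `I^γ` of a function bounded by `B`, its second is a continuous primitive starting from zero.
    refine eq_zero_of_ae_le hab (g := fun x => B * ((x - a) ^ γ / Real.Gamma (γ + 1)) +
      |leftInt 1 ((Ioo a b).indicator q) x|) ?_ ?_ ?_
    · refine Continuous.continuousAt ?_
      refine (continuous_const.mul (Continuous.div_const ?_ _)).add
        (continuous_leftInt_one hqi).abs
      exact (Real.continuous_rpow_const hγ.le).comp (continuous_id.sub continuous_const)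
    · rw [sub_self, Real.zero_rpow hγ.ne', leftInt_eq_zero (hz q) le_rfl]
      simp
    · filter_upwards [hC, ae_leftInt_leftInt hγ hδ hγδ hui a b] with x h1 h2 hm
      have h3 := abs_leftInt_le_rpow hγ (fun y hy => leftInt_eq_zero (γ := δ) (hz u) hy) hB hm
      rw [h2 hm] at h3
      have h4 : C = leftInt (γ + δ) ((Ioo a b).indicator u) x -
          leftInt 1 ((Ioo a b).indicator q) x := by rw [h1 hm]; ring
      rw [h4]
      exact (abs_sub _ _).trans (add_le_add h3 le_rfl)
  filter_upwards [hC] with x hx hm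
  rw [hx hm, hC0, zero_add]

/-- With `ψ` the right integral of order `1 - α` of `φ'`, the pairing `-∫ q ψ` equals `∫ (I^1 q)
ψ'`. Replacing `I^1 q` by `I^{1-β} u` and moving all integrations onto `φ''` gives `-∫ u I^{1-α-β}
φ'`, with right integration on `φ'`, which is the pairing of `r` with `φ`. -/
lemma IsWeakFracDeriv.semigroup_left (hΩ : IsDomain Ω) (hα : 0 < α) (hβ : 0 < β)
    (hαβ : α + β < 1) (hq : IsWeakFracDeriv .left Ω β u q)
    (hr : IsWeakFracDeriv .left Ω (α + β) u r) (hqi : IntegrableOn q Ω) (hri : IntegrableOn r Ω) :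
    IsWeakFracDeriv .left Ω α q r := by
  obtain ⟨hu, hJ⟩ := (isWeakFracDeriv_left_iff_isWeakDeriv hΩ.isOpen hβ (by linarith)).1 hq
  obtain ⟨-, hH⟩ := (isWeakFracDeriv_left_iff_isWeakDeriv hΩ.isOpen (add_pos hα hβ) hαβ).1 hr
  have hu' := integrable_indicator_of hΩ.isOpen hu
  have hq' := integrable_indicator_of hΩ.isOpen hqi
  refine (isWeakFracDeriv_left_iff_of_lt_one hΩ.isOpen hα (by linarith)).2
    ⟨hqi, hr.2.1, fun φ hφ => ?_⟩
  rw [((isWeakFracDeriv_left_iff_of_lt_one hΩ.isOpen (add_pos hα hβ) hαβ).1 hr).2.2 φ hφ]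
  have hγ : 0 < 1 - α := by linarith
  have hγ1 : 1 - α < 1 := by linarith
  set ψ := rightInt (1 - α) (deriv φ) with hψ
  set ψ' := rightInt (1 - α) (deriv (deriv φ)) with hψ'
  have hψi : Integrable ψ := hφ.integrable_rightInt_deriv hγ hγ1
  have hψi' : Integrable ψ' := hφ.deriv.integrable_rightInt_deriv hγ hγ1
  have hψd : ∀ x, HasDerivAt ψ (ψ' x) x := hasDerivAt_rightInt hγ hφ.deriv
  obtain ⟨M, -, hM⟩ := hφ.deriv.deriv.abs_rightInt_le hγ hγ1.le
  -- `ψ` lacks compact support in general but vanishes to the right of the support of `φ'`, which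
  -- suffices for the right integral of order one of `ψ'`.
  have hψ0 : Tendsto ψ atTop (𝓝 0) := by
    obtain ⟨R, hR, hR'⟩ := hφ.deriv.exists_abs_bound
    refine tendsto_const_nhds.congr' ?_
    filter_upwards [eventually_ge_atTop R] with x hx
    exact (rightInt_eq_zero (fun y hy => hR' y (hy.trans_le (le_abs_self y))) hx).symm
  have h1 : -∫ x, Ω.indicator q x * ψ x = ∫ x, leftInt 1 (Ω.indicator q) x * ψ' x := by
    rw [← integral_mul_rightInt one_pos le_rfl hq' hψi' hM]
    simp only [rightInt_one_deriv hψd hψi' hψ0, mul_neg]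
    rw [integral_neg]
  have h2 : ∫ x, leftInt (1 - β) (Ω.indicator u) x * ψ' x =
      -∫ x, Ω.indicator u x * rightInt (1 - (α + β)) (deriv φ) x := by
    rw [integral_leftInt_mul_rightInt_deriv (by linarith) (by linarith) hγ hγ1 hu' hφ.deriv,
      show 1 - β + (1 - α) = 1 - (α + β) + 1 by ring, ← integral_neg]
    congr 1; ext x
    rw [hφ.deriv.rightInt_add_one_deriv (by linarith)]
    ring
  rw [h1, ← h2]
  -- On the line the constant remains but is multiplied by `∫ ψ' = 0`; on an interval it is zero.
  -- Outside the interval both integrals vanish to the left and `ψ'` vanishes to the right.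
  rcases hΩ with rfl | ⟨a, b, hab, rfl⟩
  · obtain ⟨C, hC⟩ := hJ.exists_eq_leftInt_one isOpen_univ ordConnected_univ univ_nonempty hqi
    have h3 : ∀ᵐ x, leftInt (1 - β) (univ.indicator u) x * ψ' x =
        C * ψ' x + leftInt 1 (univ.indicator q) x * ψ' x := by
      filter_upwards [hC] with x hx
      rw [hx (mem_univ x)]
      ring
    rw [integral_congr_ae h3, integral_add (hψi'.const_mul C)
      (integrable_leftInt_mul one_pos le_rfl hq' hψi' hM), integral_const_mul,
      integral_eq_zero_of_hasDerivAt_of_integrable hψd hψi' hψi, mul_zero, zero_add]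
  · have hβ' : 1 - β = α + (1 - (α + β)) := by ring
    rw [hβ'] at hJ ⊢
    have h3 := ae_eq_leftInt_one_of_Ioo hab hα (by linarith) (by linarith) hu hqi hri hJ hH
    have hz : ∀ (f : ℝ → ℝ) (y : ℝ), y ≤ a → (Ioo a b).indicator f y = 0 := fun f y hy =>
      indicator_of_notMem (fun h => absurd h.1 (not_lt.2 hy)) _
    refine integral_congr_ae ?_
    filter_upwards [h3] with x hx
    rcases le_or_gt x a with hxa | hxa
    · rw [leftInt_eq_zero (hz u) hxa, leftInt_eq_zero (hz q) hxa]
    · rcases lt_or_ge x b with hxb | hxb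
      · rw [hx ⟨hxa, hxb⟩]
      · have : ψ' x = 0 := rightInt_eq_zero (R := b) (fun y hy =>
          hφ.deriv.deriv.eq_zero fun h => absurd h.2 (not_lt.2 hy.le)) hxb
        rw [this, mul_zero, mul_zero]

lemma IsWeakFracDeriv.semigroup {s : Side} (hΩ : IsDomain Ω) (hα : 0 < α) (hβ : 0 < β)
    (hαβ : α + β < 1) (hq : IsWeakFracDeriv s Ω β u q) (hr : IsWeakFracDeriv s Ω (α + β) u r)
    (hqi : IntegrableOn q Ω) (hri : IntegrableOn r Ω) : IsWeakFracDeriv s Ω α q r := by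
  cases s with
  | left => exact hq.semigroup_left hΩ hα hβ hαβ hr hqi hri
  | right =>
    rw [isWeakFracDeriv_right_iff hΩ.isOpen (floor_ne_self hβ (by linarith))] at hq
    rw [isWeakFracDeriv_right_iff hΩ.isOpen (floor_ne_self (add_pos hα hβ) hαβ)] at hr
    rw [isWeakFracDeriv_right_iff hΩ.isOpen (floor_ne_self hα (by linarith))]
    exact hq.semigroup_left hΩ.neg hα hβ hαβ hr (integrableOn_comp_neg hqi)
      (integrableOn_comp_neg hri)

end semigroup

/-! ### Consistency on both sides -/

section sides

variable {Ω : Set ℝ} {u w : ℝ → ℝ} {s : Side}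

lemma IsWeakDeriv.comp_neg_one (hΩ : IsOpen Ω) (h : IsWeakDeriv Ω 1 u w) :
    IsWeakDeriv (-Ω) 1 (fun x => u (-x)) (fun x => -w (-x)) := by
  simpa using h.comp_neg hΩ

lemma exists_isWeakFracDeriv_of_isWeakDeriv (hΩ : IsDomain Ω) (hu : IntegrableOn u Ω)
    (h : IsWeakDeriv Ω 1 u w) {α : ℝ} (hα : α ∈ Ioo (0 : ℝ) 1) :
    ∃ v, IsWeakFracDeriv s Ω α u v := by
  cases s with
  | left =>
    exact ⟨_, isWeakFracDeriv_marchaud hΩ.isOpen hΩ.ordConnected hΩ.nonempty hα.1 hα.2 hu h⟩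
  | right =>
    have h1 := isWeakFracDeriv_marchaud hΩ.neg.isOpen hΩ.neg.ordConnected hΩ.neg.nonempty
      hα.1 hα.2 (integrableOn_comp_neg hu) (h.comp_neg_one hΩ.isOpen)
    refine ⟨fun x => marchaud (1 - α) ((-Ω).indicator fun x => u (-x)) (-x), ?_⟩
    rw [isWeakFracDeriv_right_iff hΩ.isOpen (floor_ne_self hα.1 hα.2)]
    simpa using h1

lemma tendsto_integral_of_isWeakDeriv (hΩ : IsDomain Ω) (hu : IntegrableOn u Ω)
    (h : IsWeakDeriv Ω 1 u w) {v : ℝ → ℝ → ℝ}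
    (hv : ∀ α ∈ Ioo (0 : ℝ) 1, IsWeakFracDeriv s Ω α u (v α)) {φ : ℝ → ℝ}
    (hφ : IsTestFunction Ω φ) :
    Tendsto (fun α : ℝ => ∫ x in Ω, v α x * φ x) (𝓝[<] 1)
      (𝓝 (∫ x in Ω, (s.sign * w x) * φ x)) := by
  cases s with
  | left => simpa [Side.sign] using tendsto_integral_left hΩ.isOpen hu h hv hφ
  | right =>
    have h1 := tendsto_integral_left hΩ.neg.isOpen (integrableOn_comp_neg hu)
      (h.comp_neg_one hΩ.isOpen) (v := fun α x => v α (-x))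
      (fun α hα => (isWeakFracDeriv_right_iff hΩ.isOpen (floor_ne_self hα.1 hα.2)).1 (hv α hα))
      hφ.comp_neg
    rw [setIntegral_comp_neg Ω fun x => -w x * φ x] at h1
    have h2 : ∀ α, ∫ x in -Ω, v α (-x) * φ (-x) = ∫ x in Ω, v α x * φ x := fun α =>
      setIntegral_comp_neg Ω fun x => v α x * φ x
    simp only [h2] at h1
    simpa [Side.sign] using h1

lemma ae_tendsto_of_isWeakDeriv (hΩ : IsDomain Ω) (hu : IntegrableOn u Ω)
    (h : IsWeakDeriv Ω 1 u w) {a : ℕ → ℝ} {v : ℕ → ℝ → ℝ} (ha : ∀ k, a k ∈ Ioo (0 : ℝ) 1)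
    (ha1 : Tendsto a atTop (𝓝 1)) (hv : ∀ k, IsWeakFracDeriv s Ω (a k) u (v k)) :
    ∀ᵐ x ∂(volume.restrict Ω), Tendsto (fun k => v k x) atTop (𝓝 (s.sign * w x)) := by
  rw [ae_restrict_iff' hΩ.isOpen.measurableSet]
  cases s with
  | left =>
    simpa [Side.sign] using
      ae_tendsto_left hΩ.isOpen hΩ.ordConnected hΩ.nonempty hu h ha ha1 hv
  | right =>
    have h1 := ae_tendsto_left hΩ.neg.isOpen hΩ.neg.ordConnected hΩ.neg.nonempty
      (integrableOn_comp_neg hu) (h.comp_neg_one hΩ.isOpen) (v := fun k x => v k (-x)) ha ha1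
      (fun k => (isWeakFracDeriv_right_iff hΩ.isOpen
        (floor_ne_self (ha k).1 (ha k).2)).1 (hv k))
    filter_upwards [(Measure.measurePreserving_neg volume).quasiMeasurePreserving.ae h1]
      with x hx hxΩ
    simpa [Side.sign] using hx (by simpa using hxΩ)

end sides

end WeakFrac

theorem mainTheorem9 (s : WeakFrac.Side) (Ω : Set ℝ) (hΩ : WeakFrac.IsDomain Ω) :
    -- (i) linearity
    (∀ (α : ℝ), 0 < α → ∀ (c d : ℝ) (u v p q : ℝ → ℝ),
      WeakFrac.IsWeakFracDeriv s Ω α u p → WeakFrac.IsWeakFracDeriv s Ω α v q →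
      WeakFrac.IsWeakFracDeriv s Ω α
        (fun x => c * u x + d * v x) (fun x => c * p x + d * q x)) ∧
    -- (ii) inclusivity
    (∀ (α β : ℝ), 0 < α → α < β → β < 1 → ∀ (u v : ℝ → ℝ),
      WeakFrac.IsWeakFracDeriv s Ω β u v → ∃ w : ℝ → ℝ, WeakFrac.IsWeakFracDeriv s Ω α u w) ∧
    -- (iii) semigroup property for orders with sum below one
    (∀ (α β : ℝ), 0 < α → 0 < β → α + β < 1 → ∀ (u p q r : ℝ → ℝ),
      WeakFrac.IsWeakFracDeriv s Ω α u p → WeakFrac.IsWeakFracDeriv s Ω β u q →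
      WeakFrac.IsWeakFracDeriv s Ω (α + β) u r →
      IntegrableOn p Ω volume → IntegrableOn q Ω volume → IntegrableOn r Ω volume →
      WeakFrac.IsWeakFracDeriv s Ω α q r) ∧
    -- (iii) orders above one; a sign occurs for left derivatives of non-integer order
    (∀ (α : ℝ), 1 < α → ∀ (u v : ℝ → ℝ),
      ((s = WeakFrac.Side.right ∨ Int.fract α = 0) →
        (WeakFrac.IsWeakFracDeriv s Ω α u v ↔
          ∃ w : ℝ → ℝ, WeakFrac.IsWeakFracDeriv s Ω (Int.fract α) u w ∧
            WeakFrac.IsWeakDeriv Ω ⌊α⌋₊ w v)) ∧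
      ((s = WeakFrac.Side.left ∧ Int.fract α ≠ 0) →
        (WeakFrac.IsWeakFracDeriv s Ω α u v ↔
          ∃ w : ℝ → ℝ, WeakFrac.IsWeakFracDeriv s Ω (Int.fract α) u w ∧
            WeakFrac.IsWeakDeriv Ω ⌊α⌋₊ w (fun x => (-1) ^ ⌊α⌋₊ * v x)))) ∧
    -- (iv) consistency with the first-order weak derivative
    (∀ (u w : ℝ → ℝ), IntegrableOn u Ω volume → WeakFrac.IsWeakDeriv Ω 1 u w →
      (∀ α ∈ Set.Ioo (0 : ℝ) 1, ∃ v : ℝ → ℝ, WeakFrac.IsWeakFracDeriv s Ω α u v) ∧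
      (∀ v : ℝ → ℝ → ℝ,
        (∀ α ∈ Set.Ioo (0 : ℝ) 1, WeakFrac.IsWeakFracDeriv s Ω α u (v α)) →
        ∀ φ : ℝ → ℝ, WeakFrac.IsTestFunction Ω φ →
          Tendsto (fun α : ℝ => ∫ x in Ω, v α x * φ x) (𝓝[<] 1)
            (𝓝 (∫ x in Ω, (s.sign * w x) * φ x))) ∧
      (∀ (a : ℕ → ℝ) (v : ℕ → ℝ → ℝ), (∀ k, a k ∈ Set.Ioo (0 : ℝ) 1) →
        Tendsto a atTop (𝓝 1) → (∀ k, WeakFrac.IsWeakFracDeriv s Ω (a k) u (v k)) →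
        ∀ᵐ x ∂(volume.restrict Ω), Tendsto (fun k => v k x) atTop (𝓝 (s.sign * w x)))) := by

  refine ⟨fun α hα c d u v p q hu hv => hu.linear hα.le c d hv,
    fun α β hα hαβ hβ u v h => h.exists_of_lt hΩ hα hαβ hβ,
    fun α β hα hβ hαβ u p q r _ hq hr _ hqi hri =>
      hq.semigroup hΩ hα hβ hαβ hr hqi hri,
    fun α hα u v => ?_,
    fun u w hu h => ⟨fun α hα => WeakFrac.exists_isWeakFracDeriv_of_isWeakDeriv hΩ hu h hα,
      fun v hv φ hφ => WeakFrac.tendsto_integral_of_isWeakDeriv hΩ hu h hv hφ,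
      fun a v ha ha1 hv => WeakFrac.ae_tendsto_of_isWeakDeriv hΩ hu h ha ha1 hv⟩⟩
  have hα0 : 0 ≤ α := zero_le_one.trans hα.le
  constructor
  · intro hs
    by_cases hint : (⌊α⌋₊ : ℝ) = α
    · rw [(WeakFrac.fract_eq_zero_iff hα0).2 hint]
      exact WeakFrac.isWeakFracDeriv_natCast_iff s hint
    · obtain rfl := hs.resolve_right fun h => hint ((WeakFrac.fract_eq_zero_iff hα0).1 h)
      exact WeakFrac.isWeakFracDeriv_right_iff_fract hΩ.isOpen hΩ.ordConnected hΩ.nonempty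
        hα0 hint
  · rintro ⟨rfl, hs⟩
    exact WeakFrac.isWeakFracDeriv_left_iff_fract hΩ.isOpen hΩ.ordConnected hΩ.nonempty hα0
      fun h => hs ((WeakFrac.fract_eq_zero_iff hα0).2 h)
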